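/- Let $D$ be a finite directed pseudograph (loops and parallel arcs allowed) with a distinguished "0 node", such as a metatile-generating digraph. Each arc represents the addition of one tile, a square or a comb, and carries a nonnegative integer, the resulting increase in length, which is positive for combs. The length of a walk, cycle or circuit is the sum of the increases along its arcs; every cycle is assumed to have positive length. Cycles visit no node twice and are taken up to rotation. An inner cycle is a cycle that avoids the 0 node. Assume that $D$ has exactly four inner cycles and no node common to all of them. Two of the four are errant loops: single-arc cycles at nodes $\mathcal{E}_1$ and $\mathcal{E}_2$ such that deleting both loops (but not just one of them) leaves a digraph in which some node lies on all remaining inner cycles; let $\mathcal{P}$ (the pseudo-common node) be such a node. Let $L_1,L_2$ be the lengths of the other two inner cycles, where $\mathcal{E}_i$ lies on the $i$-th of them, let $L_3,L_4$ be the lengths of the errant loops at $\mathcal{E}_1,\mathcal{E}_2$, respectively, and let $K_r$ be the number of combs on the inner cycle of length $L_r$ ($r=1,2,3,4$). A common circuit is a simple path from the 0 node to $\mathcal{P}$ followed by a simple path from $\mathcal{P}$ to the 0 node. Assume that there are exactly two of them, of lengths $l_{\mathrm{c}1},l_{\mathrm{c}2}$ and containing $k_{\mathrm{c}1},k_{\mathrm{c}2}$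 combs, and that the $i$-th one passes through $\mathcal{E}_i$, either for both $i$ only on its second path (after $\mathcal{P}$) or for both $i$ only on its first path (before $\mathcal{P}$). Let the outer cycles, i.e. the cycles that include the 0 node but not $\mathcal{P}$, have lengths $l_{\mathrm{o}i}$ and contain $k_{\mathrm{o}i}$ combs ($i=1,\dots,N_{\mathrm{o}}$). Let $B_n$ be the number of walks (of any number of arcs, including none) from the 0 node to itself of total length $n$, and $B_{n,k}$ the number of those that contain $k$ combs. Then $B_n=0$ for $n<0$, $B_{n,k}=0$ if $k<0$ or $n<k$, and for all integers $n$ and $k$ \begin{align*} B_n&=\delta_{n,0}+\sum_{r=1}^4 (B_{n-L_r}-\delta_{n,L_r}) +\delta_{n,L_1+L_4}-B_{n-L_1-L_4}+\delta_{n,L_2+L_3}-B_{n-L_2-L_3}+\delta_{n,L_3+L_4}-B_{n-L_3-L_4}\\ &\quad+\sum_{i=1}^{N_{\mathrm{o}}}\biggl(B_{n-l_{\mathrm{o}i}}+B_{n-l_{\mathrm{o}i}-L_1-L_4}+B_{n-l_{\mathrm{o}i}-L_2-L_3}+B_{n-l_{\mathrm{o}i}-L_3-L_4}-\sum_{r=1}^4B_{n-l_{\mathrm{o}i}-L_r}\biggr)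 +\sum_{i=1}^2 (B_{n-l_{\mathrm{c}i}}-B_{n-l_{\mathrm{c}i}-L_{5-i}}),\\ B_{n,k}&=\delta_{n,0}\delta_{k,0}+\sum_{r=1}^4 (B_{n-L_r,k-K_r}-\delta_{n,L_r}\delta_{k,K_r}) +\delta_{n,L_1+L_4}\delta_{k,K_1+K_4}-B_{n-L_1-L_4,k-K_1-K_4}\\ &\quad+\delta_{n,L_2+L_3}\delta_{k,K_2+K_3}-B_{n-L_2-L_3,k-K_2-K_3} +\delta_{n,L_3+L_4}\delta_{k,K_3+K_4}-B_{n-L_3-L_4,k-K_3-K_4}\\ &\quad+\sum_{i=1}^{N_{\mathrm{o}}}\biggl(B_{n-l_{\mathrm{o}i},k-k_{\mathrm{o}i}}-\sum_{r=1}^{4}B_{n-l_{\mathrm{o}i}-L_r,k-k_{\mathrm{o}i}-K_r}+B_{n-l_{\mathrm{o}i}-L_1-L_4,k-k_{\mathrm{o}i}-K_1-K_4}\\ &\qquad\quad+B_{n-l_{\mathrm{o}i}-L_2-L_3,k-k_{\mathrm{o}i}-K_2-K_3}+B_{n-l_{\mathrm{o}i}-L_3-L_4,k-k_{\mathrm{o}i}-K_3-K_4}\biggr)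 +\sum_{i=1}^2 (B_{n-l_{\mathrm{c}i},k-k_{\mathrm{c}i}}-B_{n-l_{\mathrm{c}i}-L_{5-i},k-k_{\mathrm{c}i}-K_{5-i}}). \end{align*} Moreover, let $\mathcal{Q}$ be a finite set of positive integers, and let the $\mathcal{Q}$-comb be the tile with teeth on cells $\{0\}\cup\mathcal{Q}$. If $D$ is the metatile-generating digraph for squares and $\mathcal{Q}$-combs, then, for $n,k\ge0$, $B_n$ is the number of restricted-overlap tilings of an $n$-board with squares and $\mathcal{Q}$-combs (non-leftmost cells of combs may overlap non-leftmost cells of other combs, and no other overlap is allowed), and $B_{n,k}$ is the number of those with $k$ combs. Here the nodes of that digraph are the bit strings that record the empty (0) and filled (1) cells of the yet-to-be-completed metatile from its first empty cell to its last filled cell, as reached from the empty board, with the 0 node standing for both the empty board and the completed metatile; out of each node one arc adds a square and one arc adds a comb with its leftmost cell on the first empty cell. -/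

import Mathlib

/-- The Kronecker delta on the integers. -/
def kdelta (i j : ℤ) : ℤ := if i = j then 1 else 0

/-- The two kinds of tile: a square `S` and a comb `C`. -/
inductive Tile where
  | square
  | comb

/-- The number of combs (0 or 1) contributed by a tile. -/
def Tile.combs : Tile → ℕ
  | .square => 0
  | .comb => 1

/-- A directed pseudograph (loops and parallel arcs are allowed) with a distinguished `0` node
`zero`; each arc carries the tile that it adds and the resulting increase `incr` in the length of
the incomplete metatile. -/
structure TileDigraph (V A : Type*) where
  src : A → V
  tgt : A → V
  tile : A → Tile
  incr : A → ℕ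
  zero : V

namespace TileDigraph

variable {V A : Type*} (D : TileDigraph V A)

/-! ### Walks, cycles, lengths -/

/-- Total length of a collection of arcs (with multiplicity). -/
def len (m : Multiset A) : ℕ := (m.map D.incr).sum

/-- Total number of combs in a collection of arcs (with multiplicity). -/
def combs (m : Multiset A) : ℕ := (m.map fun a => (D.tile a).combs).sum

/-- The list of arcs `l` is a walk from `u` to `v`. -/
def IsWalk : V → V → List A → Prop
  | u, v, [] => u = v
  | u, v, a :: l => D.src a = u ∧ IsWalk (D.tgt a) v l

/-- The nodes visited, in order, by a walk that starts at `u` and has arcs `l`. -/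
def visited (u : V) (l : List A) : List V := u :: l.map D.tgt

/-- A simple path from `u` to `v`: a walk that visits no node twice. -/
def IsSimplePath (u v : V) (l : List A) : Prop :=
  D.IsWalk u v l ∧ (D.visited u l).Nodup

/-- A cycle: a cyclically ordered nonempty list of arcs (so a list up to rotation), each ending
where the next one starts, with no repeated node. Loops are cycles with a single arc. -/
def IsCycle (c : Cycle A) : Prop :=
  c ≠ Cycle.nil ∧ c.Chain (fun a b => D.tgt a = D.src b) ∧ (c.map D.src).Nodup

/-- The cycle `c` passes through the node `v`. -/
def OnCycle (v : V) (c : Cycle A) : Prop := v ∈ c.map D.src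

/-- An inner cycle: a cycle that does not include the `0` node. -/
def IsInnerCycle (c : Cycle A) : Prop := D.IsCycle c ∧ ¬ D.OnCycle D.zero c

/-- An outer cycle with respect to `P`: a cycle that includes the `0` node but not `P`. -/
def IsOuterCycle (P : V) (c : Cycle A) : Prop :=
  D.IsCycle c ∧ D.OnCycle D.zero c ∧ ¬ D.OnCycle P c

/-- A common circuit with respect to `P`: a simple path from the `0` node to `P`, followed by a
simple path from `P` to the `0` node. -/
def IsCommonCircuit (P : V) (w : List A × List A) : Prop :=
  D.IsSimplePath D.zero P w.1 ∧ D.IsSimplePath P D.zero w.2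

/-- After deletion of the arcs in `F`, the node `v` lies on all the remaining inner cycles. -/
def IsCommonNodeWithout (F : Set A) (v : V) : Prop :=
  ∀ c : Cycle A, D.IsInnerCycle c → (∀ a ∈ c, a ∉ F) → D.OnCycle v c

/-- `E` is the set of errant loops and `P` is a pseudo-common node: the arcs in `E` are loops
that are inner cycles, deleting all of `E` makes `P` a common node, and deleting only some of the
arcs in `E` (in particular, deleting none) leaves a digraph without a common node. -/
def IsErrantFamily (P : V) (E : Set A) : Prop :=
  E.Nonempty ∧ (∀ a ∈ E, D.IsInnerCycle (([a] : List A) : Cycle A)) ∧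
    D.IsCommonNodeWithout E P ∧ ∀ F : Set A, F ⊂ E → ∀ v : V, ¬ D.IsCommonNodeWithout F v

/-! ### The counts

A walk from the `0` node to itself is a succession of metatiles, i.e. a tiling of a board. -/

/-- `B n`: the number of walks from the `0` node to itself of total length `n`. -/
noncomputable def B (n : ℤ) : ℤ :=
  ({l : List A | D.IsWalk D.zero D.zero l ∧ (D.len l : ℤ) = n}.ncard : ℤ)

/-- `Bk n k`: the number of walks from the `0` node to itself of total length `n` that contain
`k` combs. -/
noncomputable def Bk (n k : ℤ) : ℤ :=
  ({l : List A | D.IsWalk D.zero D.zero l ∧ (D.len l : ℤ) = n ∧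
    (D.combs l : ℤ) = k}.ncard : ℤ)

end TileDigraph

/-! ### Restricted-overlap tilings with squares and `Q`-combs -/

/-- The cells occupied by the teeth of the `Q`-comb whose leftmost cell is cell 0. -/
def combCells (Q : Finset ℕ) : Finset ℕ := insert 0 Q

/-- The cells occupied by a tile whose leftmost cell is cell 0. -/
def tileCells (Q : Finset ℕ) : Tile → Finset ℕ
  | .square => {0}
  | .comb => combCells Q

/-- `IsTiling Q n T`: placing the leftmost cells of the `Q`-combs at the cells in `T.1` and squares
at the cells in `T.2` gives a restricted-overlap tiling of the `n`-board with cells `0, …, n - 1`: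
all tiles fit on the board, every cell is covered, and nothing overlaps except that non-leftmost
cells of combs may overlap non-leftmost cells of other combs. -/
def IsTiling (Q : Finset ℕ) (n : ℕ) (T : Finset ℕ × Finset ℕ) : Prop :=
  (∀ c ∈ T.1, ∀ x ∈ combCells Q, c + x < n) ∧
  (∀ s ∈ T.2, s < n) ∧
  (∀ c ∈ T.1, ∀ c' ∈ T.1, c ≠ c' → ∀ x ∈ combCells Q, c ≠ c' + x) ∧
  (∀ s ∈ T.2, ∀ c ∈ T.1, ∀ x ∈ combCells Q, s ≠ c + x) ∧
  (∀ i < n, i ∈ T.2 ∨ ∃ c ∈ T.1, ∃ x ∈ combCells Q, i = c + x)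

/-- The number of restricted-overlap tilings of an `n`-board with squares and `Q`-combs. -/
noncomputable def tilingCount (Q : Finset ℕ) (n : ℕ) : ℕ :=
  {T : Finset ℕ × Finset ℕ | IsTiling Q n T}.ncard

/-- The number of those tilings that contain `k` combs. -/
noncomputable def tilingCountCombs (Q : Finset ℕ) (n k : ℕ) : ℕ :=
  {T : Finset ℕ × Finset ℕ | IsTiling Q n T ∧ T.1.card = k}.ncard

/-! ### The metatile-generating digraph for squares and `Q`-combs

The bit-string label of a node is recorded as the finite set of positions of its 1s (the filled
cells), position 0 being the next empty cell; the `0` node is recorded as `∅`. -/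

/-- The filled cells after a tile is added whose leftmost cell is the next empty cell. -/
def placeTile (Q s : Finset ℕ) (t : Tile) : Finset ℕ := s ∪ tileCells Q t

/-- Remove the leading filled cells, so that position 0 is again the next empty cell. -/
noncomputable def dropFilled (u : Finset ℕ) : Finset ℕ :=
  (u.filter (sInf {i : ℕ | i ∉ u} < ·)).image (· - sInf {i : ℕ | i ∉ u})

/-- The number of cells up to and including the last filled cell. For the label of a node this is
the number of binary digits, with 0 digits for the `0` node. -/
def extent (u : Finset ℕ) : ℕ := u.sup (· + 1)

/-- The labels of nodes that can be reached from the empty board by adding tiles. -/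
def IsReachableLabel (Q s : Finset ℕ) : Prop :=
  Relation.ReflTransGen (fun u v => ∃ t : Tile, v = dropFilled (placeTile Q u t)) ∅ s

/-- `D`, with node labels `label`, is the metatile-generating digraph for restricted-overlap tiling
with squares and `Q`-combs: the nodes are the reachable labels, and out of each node there are
exactly two arcs, one for the addition of an `S` and one for the addition of a `C`. -/
structure TileDigraph.IsMetatileGenerating {V A : Type*} (D : TileDigraph V A) (Q : Finset ℕ)
    (label : V → Finset ℕ) : Prop where
  label_injective : Function.Injective label
  range_label : ∀ s, s ∈ Set.range label ↔ IsReachableLabel Q s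
  label_zero : label D.zero = ∅
  arcs : ∀ v t, ∃! a, D.src a = v ∧ D.tile a = t
  label_tgt : ∀ a, label (D.tgt a) = dropFilled (placeTile Q (label (D.src a)) (D.tile a))
  incr_eq : ∀ a,
    D.incr a = extent (placeTile Q (label (D.src a)) (D.tile a)) - extent (label (D.src a))

/-! ### Walks and cycles as lists of arcs -/

namespace TileDigraph

variable {V A : Type*} (D : TileDigraph V A)

/-! Count walks from each node `w` to the 0 node by weight (length, `c` times combs); `c = 0` gives
$B_n$ and `c = 1` gives $B_{n,k}$, so one argument serves both. These counts live in a module over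
the group ring of ℤ × ℤ, which acts by translations. Splitting off the first arc gives a linear
system with one equation per node (`walkCount_eq`). The theorem is what remains after eliminating
all nodes but the 0 node and the pseudo-common node P.

Every cycle without errant loops meets the 0 node or P, so off these two nodes only the errant loops
obstruct acyclicity. Expanding the system along the finitely many paths between the two nodes brings
in a factor 1/(1 - t) for each errant node on a path, t being the translation by the weight of its
loop. To avoid division everything is multiplied by (1 - t₂)(1 - t₃), where t₂, t₃ belong to the
errant loops; a path then keeps the factors of the errant nodes it misses
(`missedFactor_smul_walkCount`).

Paths from P to P are the two other inner cycles t₀, t₁, each meeting only its own errant node.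
Paths from the 0 node to itself are the outer cycles. Common circuits are pairs in a product set, so
having exactly two, with different paths on the errant side, leaves a single path on the other side.
Splicing an outer cycle with an inner one shows that outer cycles miss both errant nodes.
Eliminating the count at P produces the determinant (1 - t₂)(1 - t₃) - t₀(1 - t₃) - t₁(1 - t₂),
whose expansion gives the terms of the recurrence (`walkCount_recurrence`). The spare factor (1 -
t₂)(1 - t₃) cancels because the functions vanish for small length and errant loops have positive
length.

For the tiling statement, completions of a partly filled board obey the first-arc recursion of the
metatile-generating digraph: the tile covering the first empty cell is a square or a comb with its
leftmost cell there (`completionCount_label`). -/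

theorem isWalk_append {u v : V} {l m : List A} :
    D.IsWalk u v (l ++ m) ↔ ∃ w, D.IsWalk u w l ∧ D.IsWalk w v m := by
  induction l generalizing u with
  | nil => simp [IsWalk]
  | cons a l ih => simp [IsWalk, ih, and_assoc]

theorem isWalk_append_cons {u v : V} {l m : List A} {a : A} :
    D.IsWalk u v (l ++ a :: m) ↔ D.IsWalk u (D.src a) l ∧ D.IsWalk (D.src a) v (a :: m) := by
  rw [isWalk_append]
  constructor
  · rintro ⟨w, h1, h2, h3⟩
    subst h2
    exact ⟨h1, rfl, h3⟩
  · rintro ⟨h1, h2⟩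
    exact ⟨_, h1, h2⟩

theorem IsWalk.visited_eq {u v : V} {l : List A} (h : D.IsWalk u v l) :
    D.visited u l = l.map D.src ++ [v] := by
  induction l generalizing u with
  | nil => simp [IsWalk] at h; simp [visited, h]
  | cons a l ih =>
    obtain ⟨h1, h2⟩ := h
    have := ih h2
    simp only [visited, List.map_cons, List.cons_append] at this ⊢
    rw [this, h1]

/-- A walk that visits no node twice uses no loop. -/
theorem IsWalk.not_mem_of_loop {u v : V} {l : List A} (h : D.IsWalk u v l)
    (hn : (l.map D.src ++ [v]).Nodup) {b : A} (hb : D.src b = D.tgt b) : b ∉ l := by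
  intro hm
  obtain ⟨x, y, rfl⟩ := List.append_of_mem hm
  rw [isWalk_append_cons] at h
  obtain ⟨-, -, h2⟩ := h
  rw [List.map_append, List.append_assoc, List.nodup_append] at hn
  have h3 := hn.2.1
  cases y with
  | nil =>
    have : D.tgt b = v := h2
    simp [hb, this] at h3
  | cons c y => simp [h2.1, hb] at h3

/-- For `a = b` the chain runs once around a cycle; this links `Cycle.Chain` to closed walks. -/
theorem isChain_iff_isWalk {a b : A} {l : List A} :
    List.IsChain (fun a b => D.tgt a = D.src b) (a :: (l ++ [b])) ↔
      D.IsWalk (D.tgt a) (D.src b) l := by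
  induction l generalizing a with
  | nil => simp [IsWalk]
  | cons c l ih => rw [List.cons_append, List.isChain_cons_cons, ih, IsWalk, eq_comm]

theorem isCycle_coe_cons {a : A} {l : List A} :
    D.IsCycle ((a :: l : List A) : Cycle A) ↔
      D.IsWalk (D.src a) (D.src a) (a :: l) ∧ ((a :: l).map D.src).Nodup := by
  simp only [IsCycle, Cycle.chain_coe_cons, isChain_iff_isWalk, Cycle.map_coe,
    Cycle.nodup_coe_iff, IsWalk, true_and]
  simp [← Cycle.coe_nil, Cycle.coe_eq_coe]

theorem onCycle_coe {v : V} {l : List A} : D.OnCycle v (l : Cycle A) ↔ v ∈ l.map D.src := by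
  simp only [OnCycle, Cycle.map_coe, Cycle.mem_coe_iff]

/-- A walk that leaves some node twice contains a cycle. -/
theorem exists_isCycle_of_not_nodup {u v : V} {l : List A} (h : D.IsWalk u v l)
    (hn : ¬ (l.map D.src).Nodup) :
    ∃ x c y, l = x ++ c ++ y ∧ D.IsCycle (c : Cycle A) := by
  induction l generalizing u with
  | nil => simp at hn
  | cons a l ih =>
    by_cases hl : (l.map D.src).Nodup
    -- The tail repeats no node, so the segment from the head up to the recurrence of its source is
    -- a cycle.
    · have ha : D.src a ∈ l.map D.src := by
        by_contra hc
        exact hn (List.nodup_cons.2 ⟨hc, hl⟩)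
      obtain ⟨b, hb, hba⟩ := List.mem_map.1 ha
      obtain ⟨s, t, rfl⟩ := List.append_of_mem hb
      obtain ⟨-, h2⟩ := h
      rw [isWalk_append_cons, hba] at h2
      refine ⟨[], a :: s, b :: t, by simp, ?_⟩
      rw [isCycle_coe_cons]
      refine ⟨⟨rfl, h2.1⟩, ?_⟩
      rw [List.map_append, List.nodup_append] at hl
      rw [List.map_cons, List.nodup_cons]
      refine ⟨fun hc => ?_, hl.1⟩
      exact hl.2.2 _ hc _ (by simp : D.src b ∈ _) hba.symm
    · obtain ⟨x, c, y, rfl, hc⟩ := ih h.2 hl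
      exact ⟨a :: x, c, y, by simp, hc⟩

/-! ### Lengths of walks -/

@[simp] theorem len_nil : D.len (([] : List A) : Multiset A) = 0 := rfl

@[simp] theorem combs_nil : D.combs (([] : List A) : Multiset A) = 0 := rfl

@[simp] theorem len_cons (a : A) (l : List A) :
    D.len ((a :: l : List A) : Multiset A) = D.incr a + D.len (l : Multiset A) := by
  simp [len]

@[simp] theorem combs_cons (a : A) (l : List A) :
    D.combs ((a :: l : List A) : Multiset A) = (D.tile a).combs + D.combs (l : Multiset A) := by
  simp [combs]

@[simp] theorem len_append (l m : List A) :
    D.len ((l ++ m : List A) : Multiset A) = D.len (l : Multiset A) + D.len (m : Multiset A) := by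
  simp [len]

@[simp] theorem combs_append (l m : List A) :
    D.combs ((l ++ m : List A) : Multiset A) =
      D.combs (l : Multiset A) + D.combs (m : Multiset A) := by
  simp [combs]

theorem combs_le_len (hcomb : ∀ a, D.tile a = Tile.comb → 0 < D.incr a) (l : List A) :
    D.combs (l : Multiset A) ≤ D.len (l : Multiset A) := by
  induction l with
  | nil => exact le_rfl
  | cons a l ih =>
    have h := hcomb a
    rw [len_cons, combs_cons]
    cases hta : D.tile a with
    | square => simp only [Tile.combs]; omega
    | comb => have := h hta; simp only [Tile.combs]; omega

theorem length_le_of_nodup [Finite V] {l : List A} (h : (l.map D.src).Nodup) :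
    l.length ≤ Nat.card V := by
  have := Fintype.ofFinite V
  rw [Nat.card_eq_fintype_card, ← List.length_map D.src]
  exact h.length_le_card

/-- By pigeonhole such a walk leaves some node twice and so contains a cycle. -/
theorem len_pos_of_card_lt_length [Finite V]
    (hpos : ∀ c : Cycle A, D.IsCycle c → 0 < D.len c.toMultiset)
    {u v : V} {l : List A} (h : D.IsWalk u v l)
    (hl : Nat.card V < l.length) : 0 < D.len (l : Multiset A) := by
  have hn : ¬ (l.map D.src).Nodup := fun hn =>
    absurd (D.length_le_of_nodup hn) (by omega)
  obtain ⟨x, c, y, rfl, hc⟩ := D.exists_isCycle_of_not_nodup h hn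
  have := hpos _ hc
  rw [Cycle.coe_toMultiset] at this
  simp only [len_append]
  omega

/-- Single arcs may have zero increase, but each block of `Nat.card V + 1` arcs adds at least 1 to
the length. -/
theorem length_le_of_isWalk [Finite V]
    (hpos : ∀ c : Cycle A, D.IsCycle c → 0 < D.len c.toMultiset)
    (n : ℕ) {u v : V} {l : List A} (h : D.IsWalk u v l)
    (hl : D.len (l : Multiset A) ≤ n) : l.length ≤ (Nat.card V + 1) * (n + 1) := by
  induction n generalizing u l with
  | zero =>
    by_contra hc
    have := D.len_pos_of_card_lt_length hpos h (by omega)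
    omega
  | succ n ih =>
    by_cases hc : l.length ≤ Nat.card V
    · nlinarith
    · rw [← List.take_append_drop (Nat.card V + 1) l] at h hl
      obtain ⟨w, h1, h2⟩ := (D.isWalk_append).1 h
      have h3 := D.len_pos_of_card_lt_length hpos h1 (by rw [List.length_take]; omega)
      rw [len_append] at hl
      have h4 := ih h2 (by omega)
      rw [List.length_drop] at h4
      have : (Nat.card V + 1) * (n + 1 + 1) = (Nat.card V + 1) * (n + 1) + (Nat.card V + 1) := by
        ring
      omega

/-- `Set.ncard` is 0 on infinite sets, so finiteness is what makes the counts genuine. -/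
theorem finite_walks [Finite A] [Finite V]
    (hpos : ∀ c : Cycle A, D.IsCycle c → 0 < D.len c.toMultiset)
    (u v : V) (n : ℕ) :
    {l : List A | D.IsWalk u v l ∧ D.len (l : Multiset A) ≤ n}.Finite :=
  (List.finite_length_le A _).subset fun _ h => D.length_le_of_isWalk hpos n h.1 h.2

end TileDigraph

/-! ### Integer-valued functions of two integer variables as a module over shift operators -/

/-- Functions `ℤ × ℤ → ℤ`, regarded as a module over the group ring of `ℤ × ℤ`, which acts by
translations. -/
def ShiftFun : Type := ℤ × ℤ → ℤ

namespace ShiftFun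

instance : AddCommGroup ShiftFun := inferInstanceAs (AddCommGroup (ℤ × ℤ → ℤ))

/-- Translations as endomorphisms. -/
def shiftHom : Multiplicative (ℤ × ℤ) →* Module.End ℤ ShiftFun where
  toFun a :=
    { toFun := fun f m => f (m - a.toAdd)
      map_add' := fun _ _ => rfl
      map_smul' := fun _ _ => rfl }
  map_one' := by
    refine LinearMap.ext fun f => funext fun m => ?_
    change f (m - 0) = f m
    rw [sub_zero]
  map_mul' a b := by
    refine LinearMap.ext fun f => funext fun m => ?_
    change f (m - (a.toAdd + b.toAdd)) = f (m - a.toAdd - b.toAdd)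
    rw [sub_sub]

/-- The action by translations extends from the group to its group ring by the universal property.
-/
noncomputable instance : Module (AddMonoidAlgebra ℤ (ℤ × ℤ)) ShiftFun :=
  Module.compHom _ (AddMonoidAlgebra.lift ℤ _ _ shiftHom).toRingHom

/-- Translation by `a`, as an element of the group ring. -/
noncomputable def T (a : ℤ × ℤ) : AddMonoidAlgebra ℤ (ℤ × ℤ) := AddMonoidAlgebra.single a 1

theorem T_smul_apply (a : ℤ × ℤ) (f : ShiftFun) (m : ℤ × ℤ) : (T a • f) m = f (m - a) := by
  change (AddMonoidAlgebra.lift ℤ _ _ shiftHom (T a)) f m = _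
  rw [T, AddMonoidAlgebra.lift_single, one_smul]
  rfl

theorem T_add (a b : ℤ × ℤ) : T (a + b) = T a * T b := by
  rw [T, T, T, AddMonoidAlgebra.single_mul_single, one_mul]

theorem T_zero : T 0 = 1 := rfl

theorem add_apply (f g : ShiftFun) (m : ℤ × ℤ) : (f + g) m = f m + g m := rfl

theorem sub_apply (f g : ShiftFun) (m : ℤ × ℤ) : (f - g) m = f m - g m := rfl

theorem sum_apply {ι : Type*} (s : Finset ι) (f : ι → ShiftFun) (m : ℤ × ℤ) :
    (∑ i ∈ s, f i) m = ∑ i ∈ s, f i m :=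
  Finset.sum_apply m s (fun i => (f i : ℤ × ℤ → ℤ))

/-- The functions that vanish where the first variable is small. -/
noncomputable def boundedBelow : Submodule (AddMonoidAlgebra ℤ (ℤ × ℤ)) ShiftFun where
  carrier := {f | ∃ N : ℤ, ∀ m : ℤ × ℤ, m.1 < N → f m = 0}
  zero_mem' := ⟨0, fun _ _ => rfl⟩
  add_mem' := by
    rintro f g ⟨N, hN⟩ ⟨N', hN'⟩
    refine ⟨min N N', fun m hm => ?_⟩
    rw [add_apply, hN m (by omega), hN' m (by omega), add_zero]
  smul_mem' := by
    intro r f hf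
    induction r using AddMonoidAlgebra.induction_on with
    | of a =>
      obtain ⟨N, hN⟩ := hf
      refine ⟨N + a.1, fun m hm => ?_⟩
      change (T a • f) m = 0
      rw [T_smul_apply]
      exact hN _ (by simp only [Prod.fst_sub]; omega)
    | add x y hx hy =>
      obtain ⟨N, hN⟩ := hx
      obtain ⟨N', hN'⟩ := hy
      refine ⟨min N N', fun m hm => ?_⟩
      rw [add_smul, add_apply, hN m (by omega), hN' m (by omega), add_zero]
    | smul k x hx =>
      obtain ⟨N, hN⟩ := hx
      refine ⟨N, fun m hm => ?_⟩
      rw [smul_assoc]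
      change k • ((x • f) m) = 0
      rw [hN m hm, smul_zero]

/-- `1 - T a` can be cancelled on functions that are bounded below. -/
theorem eq_zero_of_one_sub_T_smul {a : ℤ × ℤ} (ha : 0 < a.1) {f : ShiftFun}
    (hf : f ∈ boundedBelow) (h : (1 - T a) • f = 0) : f = 0 := by
  obtain ⟨N, hN⟩ := hf
  -- The hypothesis says that `f` is periodic with period `a`; stepping back by `a` eventually
  -- reaches the region where `f` vanishes.
  have step : ∀ m, f m = f (m - a) := by
    intro m
    have := congrFun h m
    rw [sub_smul, one_smul] at this
    change f m - (T a • f) m = 0 at this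
    rw [T_smul_apply] at this
    omega
  have key : ∀ (k : ℕ) (m : ℤ × ℤ), m.1 < N + k → f m = 0 := by
    intro k
    induction k with
    | zero => intro m hm; exact hN m (by simpa using hm)
    | succ k ih =>
      intro m hm
      rw [step]
      refine ih _ ?_
      simp only [Prod.fst_sub]
      push_cast at hm
      omega
  funext m
  exact key (m.1 - N + 1).toNat m (by omega)

theorem eq_of_one_sub_T_smul {a : ℤ × ℤ} (ha : 0 < a.1) {f g : ShiftFun}
    (hf : f ∈ boundedBelow) (hg : g ∈ boundedBelow) (h : (1 - T a) • f = (1 - T a) • g) :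
    f = g := by
  refine sub_eq_zero.1 (eq_zero_of_one_sub_T_smul ha (boundedBelow.sub_mem hf hg) ?_)
  rw [smul_sub, h, sub_self]

/-- The indicator of the origin. -/
def delta : ShiftFun := fun m => kdelta m.1 0 * kdelta m.2 0

theorem delta_mem : delta ∈ boundedBelow := by
  refine ⟨0, fun m hm => ?_⟩
  have : ¬ m.1 = 0 := by omega
  simp [delta, kdelta, this]

end ShiftFun

/-! ### Counting walks to the `0` node -/

namespace TileDigraph

open ShiftFun

variable {V A : Type*} (D : TileDigraph V A)

/-- The weight of an arc: its length increase, and `c` times its number of combs. -/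
def arcWeight (c : ℤ) (a : A) : ℤ × ℤ := (D.incr a, c * (D.tile a).combs)

/-- The weight of a list of arcs. -/
def weight (c : ℤ) (l : List A) : ℤ × ℤ :=
  (D.len (l : Multiset A), c * D.combs (l : Multiset A))

@[simp] theorem weight_nil (c : ℤ) : D.weight c [] = 0 := by
  rw [weight, len_nil, combs_nil, Nat.cast_zero, mul_zero]
  rfl

theorem weight_cons (c : ℤ) (a : A) (l : List A) :
    D.weight c (a :: l) = D.arcWeight c a + D.weight c l := by
  simp [weight, arcWeight, mul_add]

theorem weight_append (c : ℤ) (l m : List A) :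
    D.weight c (l ++ m) = D.weight c l + D.weight c m := by
  simp [weight, mul_add]

/-- The number of walks from `w` to the `0` node, by weight. -/
noncomputable def walkCount (c : ℤ) (w : V) : ShiftFun := fun m =>
  ({l : List A | D.IsWalk w D.zero l ∧ D.weight c l = m}.ncard : ℤ)

theorem walkCount_eq_zero (c : ℤ) (w : V) {m : ℤ × ℤ} (hm : m.1 < 0) :
    D.walkCount c w m = 0 := by
  have : {l : List A | D.IsWalk w D.zero l ∧ D.weight c l = m} = ∅ := by
    ext l
    simp only [Set.mem_ofPred_eq, Set.mem_empty_iff_false, iff_false, not_and]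
    rintro - rfl
    simp only [weight] at hm
    omega
  rw [walkCount, this, Set.ncard_empty, Nat.cast_zero]

theorem walkCount_mem (c : ℤ) (w : V) : D.walkCount c w ∈ boundedBelow :=
  ⟨0, fun _ hm => D.walkCount_eq_zero c w hm⟩

theorem finite_walks_weight [Finite A] [Finite V]
    (hpos : ∀ c : Cycle A, D.IsCycle c → 0 < D.len c.toMultiset) (c : ℤ) (w : V) (m : ℤ × ℤ) :
    {l : List A | D.IsWalk w D.zero l ∧ D.weight c l = m}.Finite := by
  refine (D.finite_walks hpos w D.zero m.1.toNat).subset ?_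
  rintro l ⟨h, rfl⟩
  exact ⟨h, by simp [weight]⟩

/-- The arcs that leave a node. -/
def outArcs (w : V) : Set A := {a | D.src a = w}

@[simp] theorem mem_outArcs {w : V} {a : A} : a ∈ D.outArcs w ↔ D.src a = w := Iff.rfl

open Classical in
/-- Decomposition of walks according to the first arc. -/
theorem walkCount_eq [Finite A] [Finite V]
    (hpos : ∀ c : Cycle A, D.IsCycle c → 0 < D.len c.toMultiset) (c : ℤ) (w : V) :
    D.walkCount c w = (if w = D.zero then delta else 0) +
      ∑ᶠ a ∈ D.outArcs w, T (D.arcWeight c a) • D.walkCount c (D.tgt a) := by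
  have := Fintype.ofFinite A
  have hfin := D.finite_walks_weight hpos c
  rw [finsum_mem_eq_finite_toFinset_sum _ (Set.toFinite (D.outArcs w))]
  funext m
  rw [add_apply, sum_apply]
  let S : A → Set (List A) := fun a =>
    (a :: ·) '' {l | D.IsWalk (D.tgt a) D.zero l ∧ D.weight c l = m - D.arcWeight c a}
  let s := (Set.toFinite (D.outArcs w)).toFinset
  have hS : ∀ a, (S a).Finite := fun a => (hfin _ _).image _
  -- Nonempty walks are partitioned by their first arc.
  have hcons : {l : List A | D.IsWalk w D.zero l ∧ D.weight c l = m} \ {[]} = ⋃ a ∈ s, S a := by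
    ext l
    cases l with
    | nil => simp [S]
    | cons a l =>
      constructor
      · rintro ⟨⟨⟨h1, h2⟩, h3⟩, -⟩
        rw [weight_cons] at h3
        exact Set.mem_biUnion (x := a) (by simpa [s] using h1)
          ⟨l, ⟨h2, eq_sub_of_add_eq' h3⟩, rfl⟩
      · intro h
        obtain ⟨b, h1, l', ⟨h2, h3⟩, h4⟩ := Set.mem_iUnion₂.1 h
        obtain ⟨rfl, rfl⟩ := List.cons.inj h4
        refine ⟨⟨⟨by simpa [s] using h1, h2⟩, ?_⟩, List.cons_ne_nil _ _⟩
        rw [weight_cons, h3, add_sub_cancel]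
  have hcard : (⋃ a ∈ s, S a).ncard = ∑ a ∈ s, (S a).ncard := by
    have hs : (⋃ a ∈ s, S a) = ⋃ a : s, S a := by ext; simp
    rw [hs, Set.ncard_iUnion_of_finite (s := fun a : s => S a) fun a => hS a,
      finsum_eq_sum_of_fintype]
    · exact Finset.sum_coe_sort s fun a => (S a).ncard
    · rintro a b hab
      refine Set.disjoint_left.2 ?_
      rintro _ ⟨l, -, rfl⟩ ⟨l', -, h⟩
      exact hab (Subtype.ext (List.cons.inj h).1.symm)
  have h2 : ∀ a, (T (D.arcWeight c a) • D.walkCount c (D.tgt a)) m = ((S a).ncard : ℤ) := by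
    intro a
    rw [T_smul_apply, walkCount, Set.ncard_image_of_injective _ (List.cons_injective)]
  simp only [h2]
  rw [← Nat.cast_sum, ← hcard, ← hcons, walkCount]
  -- The empty walk is counted exactly when `w` is the 0 node and the weight is 0; it accounts for
  -- `delta`.
  by_cases h0 : w = D.zero ∧ m = 0
  · obtain ⟨rfl, rfl⟩ := h0
    rw [← Set.ncard_sdiff_singleton_add_one (a := []) (by simp [IsWalk]) (hfin _ _)]
    simp [delta, kdelta, add_comm]
  · rw [Set.sdiff_singleton_eq_self]
    · have : (if w = D.zero then delta else 0) m = 0 := by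
        split_ifs with hw
        · have : ¬ (m.1 = 0 ∧ m.2 = 0) := fun h => h0 ⟨hw, Prod.ext h.1 h.2⟩
          simp only [delta, kdelta]
          split_ifs <;> simp_all
        · rfl
      rw [this, zero_add]
    · simp only [IsWalk, weight_nil, Set.mem_ofPred_eq]
      exact fun h => h0 ⟨h.1, h.2.symm⟩

end TileDigraph

/-! ### Expansion along paths between distinguished nodes -/

namespace TileDigraph

open ShiftFun

variable {V A : Type*} (D : TileDigraph V A)

/-- The walks from `u` to `v` without arcs in `F` in which no arc leaves a node in `Z`. -/
def freePaths (Z : Set V) (F : Set A) (u v : V) : Set (List A) :=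
  {s | D.IsWalk u v s ∧ ∀ a ∈ s, a ∉ F ∧ D.src a ∉ Z}

/-- The nonempty walks from `u` to `v` without arcs in `F` in which no arc, apart from the first,
leaves a node in `Z`. -/
def excursions (Z : Set V) (F : Set A) (u v : V) : Set (List A) :=
  {s | ∃ a t, s = a :: t ∧ D.src a = u ∧ a ∉ F ∧ t ∈ D.freePaths Z F (D.tgt a) v}

variable {D} {Z : Set V} {F : Set A}

theorem excursions_eq_iUnion (u v : V) :
    D.excursions Z F u v =
      ⋃ a ∈ D.outArcs u \ F, (a :: ·) '' D.freePaths Z F (D.tgt a) v := by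
  ext s
  simp only [Set.mem_iUnion, exists_prop]
  constructor
  · rintro ⟨a, t, rfl, h1, h2, h3⟩
    exact ⟨a, ⟨h1, h2⟩, t, h3, rfl⟩
  · rintro ⟨a, ⟨h1, h2⟩, t, h3, rfl⟩
    exact ⟨a, t, rfl, h1, h2, h3⟩

/-- Outside `Z` the exemption of the first arc is void, and an empty path would put `u` in `Z`. -/
theorem freePaths_eq_excursions {u v : V} (hu : u ∉ Z) (hv : v ∈ Z) :
    D.freePaths Z F u v = D.excursions Z F u v := by
  ext s
  cases s with
  | nil =>
    constructor
    · rintro ⟨h, -⟩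
      exact absurd (show u = v from h) fun h => hu (h ▸ hv)
    · rintro ⟨a, t, h, -⟩
      cases h
  | cons a t =>
    constructor
    · rintro ⟨⟨h1, h2⟩, h3⟩
      exact ⟨a, t, rfl, h1, (h3 a (by simp)).1, h2, fun b hb => h3 b (by simp [hb])⟩
    · rintro ⟨b, t', h, h1, h2, h3, h4⟩
      cases h
      refine ⟨⟨h1, h3⟩, fun b hb => ?_⟩
      rcases List.mem_cons.1 hb with rfl | hb
      · exact ⟨h2, h1 ▸ hu⟩
      · exact h4 b hb

theorem freePaths_of_mem {u v : V} (hu : u ∈ Z) {s : List A} (h : s ∈ D.freePaths Z F u v) :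
    s = [] ∧ u = v := by
  cases s with
  | nil => exact ⟨rfl, h.1⟩
  | cons a t => exact absurd (h.1.1 ▸ hu) (h.2 a (by simp)).2

theorem freePaths_self {u : V} (hu : u ∈ Z) : D.freePaths Z F u u = {[]} := by
  ext s
  refine ⟨fun h => (freePaths_of_mem hu h).1, ?_⟩
  rintro rfl
  exact ⟨rfl, by simp⟩

theorem freePaths_eq_empty {u v : V} (hu : u ∈ Z) (huv : u ≠ v) :
    D.freePaths Z F u v = ∅ := by
  ext s
  exact ⟨fun h => huv (freePaths_of_mem hu h).2, fun h => h.elim⟩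

/-- A repeated node would give a cycle without arcs in `F` that avoids `Z`, against `hac`. Hence
free paths are bounded in length and finite in number. -/
theorem nodup_of_mem_freePaths
    (hac : ∀ c : Cycle A, D.IsCycle c → (∀ a ∈ c, a ∉ F) → ∃ v ∈ Z, D.OnCycle v c)
    {u v : V} {s : List A} (h : s ∈ D.freePaths Z F u v) : (s.map D.src).Nodup := by
  by_contra hn
  obtain ⟨x, c, y, rfl, hc⟩ := D.exists_isCycle_of_not_nodup h.1 hn
  obtain ⟨v, hv, hvc⟩ := hac _ hc fun a ha => (h.2 a (by
    rw [Cycle.mem_coe_iff] at ha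
    simp [ha])).1
  rw [onCycle_coe] at hvc
  obtain ⟨a, ha, rfl⟩ := List.mem_map.1 hvc
  exact (h.2 a (by simp [ha])).2 hv

theorem finite_freePaths [Finite V] [Finite A]
    (hac : ∀ c : Cycle A, D.IsCycle c → (∀ a ∈ c, a ∉ F) → ∃ v ∈ Z, D.OnCycle v c) (u v : V) :
    (D.freePaths Z F u v).Finite :=
  (List.finite_length_le A (Nat.card V)).subset fun _ h =>
    D.length_le_of_nodup (nodup_of_mem_freePaths hac h)

theorem finsum_excursions [Finite V] [Finite A]
    (hac : ∀ c : Cycle A, D.IsCycle c → (∀ a ∈ c, a ∉ F) → ∃ v ∈ Z, D.OnCycle v c)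
    {M : Type*} [AddCommMonoid M] (u v : V) (f : List A → M) :
    ∑ᶠ s ∈ D.excursions Z F u v, f s =
      ∑ᶠ a ∈ D.outArcs u \ F, ∑ᶠ s ∈ D.freePaths Z F (D.tgt a) v, f (a :: s) := by
  rw [excursions_eq_iUnion, finsum_mem_biUnion _ (Set.toFinite _)
    fun a _ => (finite_freePaths hac _ _).image _]
  · exact finsum_mem_congr rfl fun a _ => finsum_mem_image List.cons_injective.injOn
  · rintro a - b - hab
    refine Set.disjoint_left.2 ?_
    rintro _ ⟨l, -, rfl⟩ ⟨l', -, h⟩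
    exact hab (List.cons.inj h).1.symm

/-- The factors are cancelled one at a time; the intermediate functions stay bounded below because
these form a submodule. -/
theorem eq_of_prod_smul {ι : Type*} (s : Finset ι) (g : ι → AddMonoidAlgebra ℤ (ℤ × ℤ))
    (hg : ∀ i ∈ s, ∀ f f' : ShiftFun, f ∈ boundedBelow → f' ∈ boundedBelow →
      g i • f = g i • f' → f = f') {f f' : ShiftFun} (hf : f ∈ boundedBelow)
    (hf' : f' ∈ boundedBelow) (h : (∏ i ∈ s, g i) • f = (∏ i ∈ s, g i) • f') : f = f' := by
  classical
  induction s using Finset.induction_on with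
  | empty => simpa using h
  | insert i s hi ih =>
    rw [Finset.prod_insert hi, mul_smul, mul_smul] at h
    exact ih (fun j hj => hg j (Finset.mem_insert_of_mem hj))
      (hg i (Finset.mem_insert_self i s) _ _ (boundedBelow.smul_mem _ hf)
        (boundedBelow.smul_mem _ hf') h)

variable {ι : Type*} [Fintype ι] (E : ι → A)

open Classical in
/-- The product of `1 - T` over the loops at nodes that no arc of the path leaves. -/
noncomputable def missedFactor (D : TileDigraph V A) (E : ι → A) (c : ℤ) (s : List A) :
    AddMonoidAlgebra ℤ (ℤ × ℤ) :=
  ∏ i, if D.src (E i) ∈ s.map D.src then 1 else 1 - T (D.arcWeight c (E i))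

open Classical in
/-- The factor `1 - T` belonging to the loop at `w`, if there is one. -/
noncomputable def nodeFactor (D : TileDigraph V A) (E : ι → A) (c : ℤ) (w : V) :
    AddMonoidAlgebra ℤ (ℤ × ℤ) :=
  ∏ i, if D.src (E i) = w then 1 - T (D.arcWeight c (E i)) else 1

/-- A new first node stops being missed, so its factor moves out of the product. -/
theorem missedFactor_cons (c : ℤ) (a : A) {s : List A} (h : D.src a ∉ s.map D.src) :
    missedFactor D E c s = nodeFactor D E c (D.src a) * missedFactor D E c (a :: s) := by
  rw [missedFactor, nodeFactor, missedFactor, ← Finset.prod_mul_distrib]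
  refine Finset.prod_congr rfl fun i _ => ?_
  by_cases h1 : D.src (E i) = D.src a
  · rw [h1, if_neg h, if_pos rfl, if_pos (by simp), mul_one]
  · rw [if_neg h1, one_mul]
    by_cases h2 : D.src (E i) ∈ s.map D.src
    · rw [if_pos h2, if_pos (by rw [List.map_cons]; exact List.mem_cons_of_mem _ h2)]
    · rw [if_neg h2, if_neg (by rw [List.map_cons, List.mem_cons, not_or]; exact ⟨h1, h2⟩)]

/-- The sum over the free paths from `w` to `v`. -/
noncomputable def pathSum (D : TileDigraph V A) (Z : Set V) (E : ι → A) (c : ℤ) (w v : V) :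
    ShiftFun :=
  ∑ᶠ s ∈ D.freePaths Z (Set.range E) w v,
    (T (D.weight c s) * missedFactor D E c s) • D.walkCount c v

theorem finsum_mem_mem {M R : Type*} [Semiring R] [AddCommMonoid M] [Module R M]
    (N : Submodule R M) {α : Type*} {s : Set α} {f : α → M} (h : ∀ a ∈ s, f a ∈ N) :
    ∑ᶠ a ∈ s, f a ∈ N :=
  finsum_mem_induction (· ∈ N) N.zero_mem (fun _ _ => N.add_mem) h

section Expansion

variable {E}

/-- This is the first-arc equation at `w` with the errant-loop term, which returns to `w`, moved to
the left side. -/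
theorem nodeFactor_smul_walkCount [Finite V] [Finite A]
    (hpos : ∀ c : Cycle A, D.IsCycle c → 0 < D.len c.toMultiset)
    (hloop : ∀ i, D.src (E i) = D.tgt (E i)) (hinj : Function.Injective fun i => D.src (E i))
    (c : ℤ) {w : V} (hw : w ≠ D.zero) :
    nodeFactor D E c w • D.walkCount c w =
      ∑ᶠ a ∈ D.outArcs w \ Set.range E, T (D.arcWeight c a) • D.walkCount c (D.tgt a) := by
  have h := D.walkCount_eq hpos c w
  rw [if_neg hw, zero_add] at h
  by_cases hi : ∃ i, D.src (E i) = w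
  · obtain ⟨i, rfl⟩ := hi
    -- By injectivity of the loop nodes there is just one errant loop here.
    have h1 : D.outArcs (D.src (E i)) = insert (E i) (D.outArcs (D.src (E i)) \ Set.range E) := by
      ext a
      constructor
      · intro ha
        by_cases hE : a ∈ Set.range E
        · obtain ⟨j, rfl⟩ := hE
          rw [hinj (show D.src (E j) = D.src (E i) from ha)]
          exact Set.mem_insert _ _
        · exact Set.mem_insert_of_mem _ ⟨ha, hE⟩
      · rintro (rfl | ha)
        · rfl
        · exact ha.1
    have h2 : nodeFactor D E c (D.src (E i)) = 1 - T (D.arcWeight c (E i)) := by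
      rw [nodeFactor, Finset.prod_eq_single i]
      · rw [if_pos rfl]
      · intro j _ hj
        exact if_neg fun h => hj (hinj h)
      · simp
    rw [h1, finsum_mem_insert _ (fun h => h.2 ⟨i, rfl⟩) (Set.toFinite _), ← hloop] at h
    rw [h2, sub_smul, one_smul, sub_eq_iff_eq_add, add_comm]
    exact h
  · have h1 : D.outArcs w \ Set.range E = D.outArcs w := by
      refine sdiff_eq_left.2 (Set.disjoint_left.2 ?_)
      rintro _ ha ⟨i, rfl⟩
      exact hi ⟨i, ha⟩
    have h2 : nodeFactor D E c w = 1 :=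
      Finset.prod_eq_one fun i _ => if_neg fun h => hi ⟨i, h⟩
    rw [h1, h2, one_smul, h]

theorem pathSum_self (Z : Set V) (c : ℤ) {v : V} (hv : v ∈ Z) :
    pathSum D Z E c v v = missedFactor D E c [] • D.walkCount c v := by
  rw [pathSum, freePaths_self hv, finsum_mem_singleton, weight_nil, T_zero, one_mul]

theorem pathSum_eq_zero (Z : Set V) (c : ℤ) {u v : V} (hu : u ∈ Z) (h : u ≠ v) :
    pathSum D Z E c u v = 0 := by
  rw [pathSum, freePaths_eq_empty hu h, finsum_mem_empty]

variable [Finite V] [Finite A]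
  (hpos : ∀ c : Cycle A, D.IsCycle c → 0 < D.len c.toMultiset) {P : V} (hP : D.zero ≠ P)
  (hac : ∀ c : Cycle A, D.IsCycle c → (∀ a ∈ c, a ∉ Set.range E) →
    ∃ v ∈ ({D.zero, P} : Set V), D.OnCycle v c)
  (hloop : ∀ i, D.src (E i) = D.tgt (E i)) (hinj : Function.Injective fun i => D.src (E i))
  (hincr : ∀ i, 0 < D.incr (E i)) (hZ : ∀ i, D.src (E i) ∉ ({D.zero, P} : Set V))

/-- The factor refers to `s.tail` because the prefixed arc has not yet been credited with visiting
its source. -/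
theorem finsum_smul_pathSum (hac : ∀ c : Cycle A, D.IsCycle c → (∀ a ∈ c, a ∉ Set.range E) →
      ∃ v ∈ Z, D.OnCycle v c) (c : ℤ) (u v : V) :
    ∑ᶠ a ∈ D.outArcs u \ Set.range E, T (D.arcWeight c a) • pathSum D Z E c (D.tgt a) v =
      ∑ᶠ s ∈ D.excursions Z (Set.range E) u v,
        (T (D.weight c s) * missedFactor D E c s.tail) • D.walkCount c v := by
  rw [finsum_excursions hac]
  refine finsum_mem_congr rfl fun a _ => ?_
  rw [pathSum, smul_finsum_mem (finite_freePaths hac _ _)]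
  refine finsum_mem_congr rfl fun s _ => ?_
  rw [List.tail_cons, weight_cons, T_add, smul_smul, mul_assoc]

include hpos hP hac hloop hinj hincr in
-- Off `Z` and without the errant loops the digraph is acyclic, so the first-arc equations can be
-- substituted into each other until every term ends at the 0 node or at `P`.
theorem missedFactor_smul_walkCount (c : ℤ) (w : V) :
    missedFactor D E c [] • D.walkCount c w =
      pathSum D {D.zero, P} E c w D.zero + pathSum D {D.zero, P} E c w P := by
  -- The induction is on a bound for the lengths of the free paths from `w`, which the number of
  -- nodes supplies.
  suffices H : ∀ (n : ℕ) (w : V), (∀ v, ∀ s ∈ D.freePaths {D.zero, P} (Set.range E) w v,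
      s.length < n) → missedFactor D E c [] • D.walkCount c w =
      pathSum D {D.zero, P} E c w D.zero + pathSum D {D.zero, P} E c w P from
    H (Nat.card V + 1) w fun v s hs =>
      Nat.lt_succ_of_le (D.length_le_of_nodup (nodup_of_mem_freePaths hac hs))
  intro n
  induction n with
  | zero => intro w hw; exact absurd (hw w [] ⟨rfl, by simp⟩) (by simp)
  | succ n ih =>
    intro w hw
    by_cases hwZ : w ∈ ({D.zero, P} : Set V)
    · rcases hwZ with rfl | rfl
      · rw [pathSum_self _ _ (by simp), pathSum_eq_zero _ _ (by simp) hP, add_zero]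
      · rw [pathSum_self _ _ (by simp), pathSum_eq_zero _ _ (by simp) hP.symm, zero_add]
    -- Prefixing an arc that leaves `w` trades the missed factor of the tail for the node factor of
    -- `w` times that of the whole path.
    · have key : ∀ v ∈ ({D.zero, P} : Set V),
          ∑ᶠ a ∈ D.outArcs w \ Set.range E,
            T (D.arcWeight c a) • pathSum D {D.zero, P} E c (D.tgt a) v =
          nodeFactor D E c w • pathSum D {D.zero, P} E c w v := by
        intro v hv
        rw [finsum_smul_pathSum hac, pathSum, smul_finsum_mem (finite_freePaths hac _ _),
          freePaths_eq_excursions hwZ hv]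
        refine finsum_mem_congr rfl ?_
        intro s hs
        have hn := nodup_of_mem_freePaths hac ((freePaths_eq_excursions hwZ hv).symm ▸ hs)
        obtain ⟨a, t, rfl, rfl, -⟩ := hs
        rw [List.tail_cons, missedFactor_cons E c a (List.nodup_cons.1 hn).1, smul_smul]
        congr 1
        ring
      have hmem : ∀ v, pathSum D {D.zero, P} E c w v ∈ boundedBelow := fun v =>
        finsum_mem_mem _ fun s _ => boundedBelow.smul_mem _ (D.walkCount_mem c v)
      -- The node factor is a product of 1s and of cancellable `1 - T`, so it suffices to prove the
      -- identity multiplied by it.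
      refine eq_of_prod_smul Finset.univ _ ?_ (boundedBelow.smul_mem _ (D.walkCount_mem c w))
        (boundedBelow.add_mem (hmem _) (hmem _))
        (show nodeFactor D E c w • _ = nodeFactor D E c w • _ from ?_)
      · intro i _ f f' hf hf' h
        split_ifs at h
        · exact eq_of_one_sub_T_smul (by simpa [arcWeight] using hincr i) hf hf' h
        · simpa using h
      · rw [smul_comm, nodeFactor_smul_walkCount hpos hloop hinj c
          (fun h => hwZ (by simp [h])), smul_finsum_mem (Set.toFinite _), smul_add,
          ← key _ (by simp), ← key _ (by simp), ← finsum_mem_add_distrib (Set.toFinite _)]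
        refine finsum_mem_congr rfl ?_
        rintro a ⟨rfl, haE⟩
        rw [smul_comm, ih, smul_add]
        intro v s hs
        have := hw v (a :: s) ⟨⟨rfl, hs.1⟩, fun b hb => by
          rcases List.mem_cons.1 hb with rfl | hb
          · exact ⟨haE, hwZ⟩
          · exact hs.2 b hb⟩
        simpa using this

open Classical in
include hpos hP hac hloop hinj hincr hZ in
/-- Decomposition of the walks from a distinguished node according to their first excursion. -/
theorem missedFactor_smul_walkCount_of_mem (c : ℤ) {u : V} (hu : u ∈ ({D.zero, P} : Set V)) :
    missedFactor D E c [] • D.walkCount c u =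
      missedFactor D E c [] • (if u = D.zero then delta else 0) +
      (∑ᶠ s ∈ D.excursions {D.zero, P} (Set.range E) u D.zero,
        (T (D.weight c s) * missedFactor D E c s) • D.walkCount c D.zero) +
      ∑ᶠ s ∈ D.excursions {D.zero, P} (Set.range E) u P,
        (T (D.weight c s) * missedFactor D E c s) • D.walkCount c P := by
  have h1 : D.outArcs u \ Set.range E = D.outArcs u := by
    refine sdiff_eq_left.2 (Set.disjoint_left.2 ?_)
    rintro _ ha ⟨i, rfl⟩
    exact hZ i (by rwa [show D.src (E i) = u from ha])
  have h2 : ∀ v, ∑ᶠ s ∈ D.excursions {D.zero, P} (Set.range E) u v,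
        (T (D.weight c s) * missedFactor D E c s) • D.walkCount c v =
      ∑ᶠ a ∈ D.outArcs u \ Set.range E,
        T (D.arcWeight c a) • pathSum D {D.zero, P} E c (D.tgt a) v := by
    intro v
    rw [finsum_smul_pathSum hac]
    refine finsum_mem_congr rfl ?_
    rintro s ⟨a, t, rfl, rfl, -, -, h⟩
    -- No errant loop sits at a distinguished node, so the tail and the whole excursion miss the
    -- same loops.
    have h3 : nodeFactor D E c (D.src a) = 1 :=
      Finset.prod_eq_one fun i _ => if_neg fun h => hZ i (by rwa [h])
    rw [List.tail_cons, missedFactor_cons E c a (s := t), h3, one_mul]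
    intro hm
    obtain ⟨b, hb, hba⟩ := List.mem_map.1 hm
    exact (h b hb).2 (hba ▸ hu)
  rw [D.walkCount_eq hpos c u, smul_add, add_assoc, h2, h2, h1,
    ← finsum_mem_add_distrib (Set.toFinite _), smul_finsum_mem (Set.toFinite _)]
  congr 1
  refine finsum_mem_congr rfl ?_
  intro a _
  rw [smul_comm, missedFactor_smul_walkCount hpos hP hac hloop hinj hincr, smul_add]

end Expansion

end TileDigraph

/-! ### Excursions, cycles and simple paths -/

namespace TileDigraph

variable {V A : Type*} {D : TileDigraph V A} {Z : Set V} {F : Set A}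

/-- Rotated to start with the loop, a longer cycle would leave the same node again with its second
arc. -/
theorem eq_singleton_of_loop_mem {c : Cycle A} (hc : D.IsCycle c) {a : A} (ha : a ∈ c)
    (hloop : D.src a = D.tgt a) : c = (([a] : List A) : Cycle A) := by
  induction c using Quotient.inductionOn with
  | h l =>
    change D.IsCycle (l : Cycle A) at hc
    change (l : Cycle A) = _
    obtain ⟨x, y, rfl⟩ := List.append_of_mem (Cycle.mem_coe_iff.1 ha)
    have hr : ((x ++ a :: y : List A) : Cycle A) = ((a :: y ++ x : List A) : Cycle A) :=
      Cycle.coe_eq_coe.2 List.isRotated_append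
    rw [hr] at hc ⊢
    rw [List.cons_append, isCycle_coe_cons] at hc
    rw [List.cons_append]
    cases hxy : y ++ x with
    | nil => rfl
    | cons b t =>
      rw [hxy] at hc
      obtain ⟨⟨-, h1, -⟩, h2⟩ := hc
      simp [h1, ← hloop] at h2

theorem excursions_append {u v w : V} {x y : List A} (hx : x ∈ D.excursions Z F u w)
    (hy : y ∈ D.freePaths Z F w v) : x ++ y ∈ D.excursions Z F u v := by
  obtain ⟨a, t, rfl, h1, h2, h3, h4⟩ := hx
  refine ⟨a, t ++ y, rfl, h1, h2, (D.isWalk_append).2 ⟨w, h3, hy.1⟩, fun b hb => ?_⟩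
  rcases List.mem_append.1 hb with hb | hb
  · exact h4 b hb
  · exact hy.2 b hb

/-- The second part retains the arc that leaves `e`, so `e` stays visible after splicing with
another path. -/
theorem freePaths_split {u v e : V} {s : List A} (hs : s ∈ D.freePaths Z F u v)
    (he : e ∈ s.map D.src) :
    ∃ x y, s = x ++ y ∧ x ∈ D.freePaths Z F u e ∧ y ∈ D.freePaths Z F e v ∧
      e ∈ y.map D.src := by
  obtain ⟨b, hb, rfl⟩ := List.mem_map.1 he
  obtain ⟨x, y, rfl⟩ := List.append_of_mem hb
  obtain ⟨h1, h2⟩ := hs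
  rw [isWalk_append_cons] at h1
  exact ⟨x, b :: y, rfl, ⟨h1.1, fun a ha => h2 a (by simp [ha])⟩,
    ⟨h1.2, fun a ha => h2 a (List.mem_append_right _ ha)⟩, by simp⟩

theorem excursions_split {u v e : V} {s : List A} (hs : s ∈ D.excursions Z F u v)
    (he : e ∈ s.map D.src) (heu : e ≠ u) :
    ∃ x y, s = x ++ y ∧ x ∈ D.excursions Z F u e ∧ y ∈ D.freePaths Z F e v ∧
      e ∈ y.map D.src := by
  obtain ⟨a, t, rfl, h1, h2, h3⟩ := hs
  rw [List.map_cons, List.mem_cons, h1, or_iff_right heu] at he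
  obtain ⟨x, y, rfl, hx, hy, hey⟩ := freePaths_split h3 he
  exact ⟨a :: x, y, rfl, ⟨a, x, rfl, h1, h2, hx⟩, hy, hey⟩

theorem isWalk_of_mem_excursions {u v : V} {s : List A} (hs : s ∈ D.excursions Z F u v) :
    D.IsWalk u v s := by
  obtain ⟨a, t, rfl, h1, h2, h3⟩ := hs
  exact ⟨h1, h3.1⟩

theorem nodup_of_mem_excursions
    (hac : ∀ c : Cycle A, D.IsCycle c → (∀ a ∈ c, a ∉ F) → ∃ v ∈ Z, D.OnCycle v c)
    {u v : V} (hu : u ∈ Z) {s : List A} (hs : s ∈ D.excursions Z F u v) :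
    (s.map D.src).Nodup := by
  obtain ⟨a, t, rfl, h1, h2, h3⟩ := hs
  rw [List.map_cons, List.nodup_cons]
  refine ⟨fun h => ?_, nodup_of_mem_freePaths hac h3⟩
  obtain ⟨b, hb, hba⟩ := List.mem_map.1 h
  exact (h3.2 b hb).2 (by rw [hba, h1]; exact hu)

theorem eq_of_mem_excursions {u v w : V} {s : List A} (hs : s ∈ D.excursions Z F u v)
    (hw : w ∈ Z) (h : w ∈ s.map D.src) : w = u := by
  obtain ⟨a, t, rfl, h1, h2, h3⟩ := hs
  rcases List.mem_cons.1 h with h | h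
  · rw [h, h1]
  · obtain ⟨b, hb, rfl⟩ := List.mem_map.1 h
    exact absurd hw (h3.2 b hb).2

theorem start_mem_of_mem_excursions {u v : V} {s : List A} (hs : s ∈ D.excursions Z F u v) :
    u ∈ s.map D.src := by
  obtain ⟨a, t, rfl, rfl, -⟩ := hs
  simp

theorem isCycle_of_mem_excursions
    (hac : ∀ c : Cycle A, D.IsCycle c → (∀ a ∈ c, a ∉ F) → ∃ v ∈ Z, D.OnCycle v c)
    {u : V} (hu : u ∈ Z) {s : List A} (hs : s ∈ D.excursions Z F u u) :
    D.IsCycle (s : Cycle A) := by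
  have h := nodup_of_mem_excursions hac hu hs
  have h' := isWalk_of_mem_excursions hs
  obtain ⟨a, t, rfl, rfl, -⟩ := hs
  exact (D.isCycle_coe_cons).2 ⟨h', h⟩

/-- Rotate the cycle to start at `u`. It contains no arc of `F`, for otherwise it would be a single
loop at a node outside `Z` and miss `u`. -/
theorem exists_mem_excursions (hF : ∀ a ∈ F, D.src a = D.tgt a ∧ D.src a ∉ Z) {u : V}
    (hu : u ∈ Z) {c : Cycle A} (hc : D.IsCycle c) (huc : D.OnCycle u c)
    (hZ : ∀ v ∈ Z, D.OnCycle v c → v = u) :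
    ∃ s ∈ D.excursions Z F u u, (s : Cycle A) = c := by
  have hcF : ∀ a ∈ c, a ∉ F := by
    intro a ha haF
    obtain ⟨h1, h2⟩ := hF a haF
    rw [eq_singleton_of_loop_mem hc ha h1, onCycle_coe] at huc
    simp only [List.map_cons, List.map_nil, List.mem_singleton] at huc
    exact h2 (huc ▸ hu)
  induction c using Quotient.inductionOn with
  | h l =>
    change D.IsCycle (l : Cycle A) at hc
    change D.OnCycle u (l : Cycle A) at huc
    change ∀ v ∈ Z, D.OnCycle v (l : Cycle A) → v = u at hZ
    change ∀ a ∈ (l : Cycle A), a ∉ F at hcF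
    change ∃ s ∈ D.excursions Z F u u, (s : Cycle A) = (l : Cycle A)
    rw [onCycle_coe] at huc
    obtain ⟨a, ha, rfl⟩ := List.mem_map.1 huc
    obtain ⟨x, y, rfl⟩ := List.append_of_mem ha
    have hr : ((x ++ a :: y : List A) : Cycle A) = ((a :: (y ++ x) : List A) : Cycle A) :=
      Cycle.coe_eq_coe.2 List.isRotated_append
    rw [hr] at hc hZ hcF ⊢
    rw [isCycle_coe_cons] at hc
    refine ⟨_, ⟨a, y ++ x, rfl, rfl, hcF a (by simp), hc.1.2, fun b hb => ⟨?_, ?_⟩⟩, rfl⟩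
    · exact hcF b (by rw [Cycle.mem_coe_iff]; exact List.mem_cons_of_mem _ hb)
    · intro hbZ
      have hb' : D.src b ∈ (y ++ x).map D.src := List.mem_map_of_mem hb
      have := hZ _ hbZ ((D.onCycle_coe).2 (by
        rw [List.map_cons]; exact List.mem_cons_of_mem _ hb'))
      rw [List.map_cons, List.nodup_cons] at hc
      exact hc.2.1 (this ▸ hb')

/-- An excursion leaves `u` only once, so a rotation that again starts at `u` is trivial. -/
theorem coe_injOn_excursions
    (hac : ∀ c : Cycle A, D.IsCycle c → (∀ a ∈ c, a ∉ F) → ∃ v ∈ Z, D.OnCycle v c)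
    {u : V} (hu : u ∈ Z) :
    Set.InjOn (fun s : List A => (s : Cycle A)) (D.excursions Z F u u) := by
  intro s hs s' hs' h
  have hn := nodup_of_mem_excursions hac hu hs
  obtain ⟨n, hn', rfl⟩ := List.isRotated_iff_mod.1 (Cycle.coe_eq_coe.1 h)
  rw [List.rotate_eq_drop_append_take hn'] at hs' ⊢
  obtain ⟨x, y, hx, hy, rfl⟩ : ∃ x y, x = s.take n ∧ y = s.drop n ∧ s = x ++ y :=
    ⟨_, _, rfl, rfl, (List.take_append_drop n s).symm⟩
  rw [← hx, ← hy] at hs' ⊢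
  cases x with
  | nil => simp
  | cons a x =>
    cases y with
    | nil => simp
    | cons b y =>
      obtain ⟨_, _, h1, h2, -⟩ := hs
      obtain ⟨_, _, h3, h4, -⟩ := hs'
      obtain ⟨rfl, -⟩ := List.cons.inj h1
      obtain ⟨rfl, -⟩ := List.cons.inj h3
      simp [h2, h4] at hn

/-- A simple path uses no loop and leaves neither endpoint midway; conversely an excursion repeats
no node by acyclicity off `Z`. -/
theorem mem_excursions_iff_isSimplePath
    (hac : ∀ c : Cycle A, D.IsCycle c → (∀ a ∈ c, a ∉ F) → ∃ v ∈ Z, D.OnCycle v c)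
    (hF : ∀ a ∈ F, D.src a = D.tgt a) {u v : V} (huv : u ≠ v) (hZ : ∀ w, w ∈ Z ↔ w = u ∨ w = v)
    {s : List A} : s ∈ D.excursions Z F u v ↔ D.IsSimplePath u v s := by
  constructor
  · intro hs
    have hw := isWalk_of_mem_excursions hs
    refine ⟨hw, ?_⟩
    rw [hw.visited_eq, List.nodup_append]
    refine ⟨nodup_of_mem_excursions hac ((hZ u).2 (Or.inl rfl)) hs, by simp, ?_⟩
    intro a ha b hb hab
    rw [List.mem_singleton.1 hb] at hab
    subst hab
    exact huv (eq_of_mem_excursions hs ((hZ _).2 (Or.inr rfl)) ha).symm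
  · rintro ⟨h1, h2⟩
    rw [h1.visited_eq] at h2
    have hF' : ∀ a ∈ s, a ∉ F := fun a ha haF => h1.not_mem_of_loop D h2 (hF a haF) ha
    cases s with
    | nil => exact absurd h1 huv
    | cons a t =>
      obtain ⟨rfl, h1⟩ := h1
      refine ⟨a, t, rfl, rfl, hF' a (by simp), h1, fun b hb => ⟨hF' b (by simp [hb]), ?_⟩⟩
      have hb' : D.src b ∈ t.map D.src := List.mem_map_of_mem hb
      rw [List.map_cons, List.cons_append, List.nodup_cons, List.nodup_append] at h2
      rw [hZ]
      rintro (h | h)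
      · exact h2.1 (List.mem_append_left _ (h ▸ hb'))
      · exact h2.2.2.2 _ hb' v (by simp) h

end TileDigraph

namespace TileDigraph

open ShiftFun

variable {V A : Type*} {D : TileDigraph V A}

/-! ### Two errant loops -/

section Links

variable {Z : Set V} {F : Set A} {P : V} {e : Fin 2 → V} {c : Fin 2 → List A}

/-- There is no free path between the two errant loop nodes. -/
theorem not_mem_freePaths_errant (hP : P ∈ Z) (heZ : ∀ i, e i ∉ Z)
    (hc : ∀ i, c i ∈ D.excursions Z F P P) (hce : ∀ i, e i ∈ (c i).map D.src)
    (hcn : ∀ i j, i ≠ j → e j ∉ (c i).map D.src)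
    (hall : ∀ s ∈ D.excursions Z F P P, ∃ i, s = c i) {i j : Fin 2} (hij : i ≠ j)
    (l : List A) : l ∉ D.freePaths Z F (e i) (e j) := by
  intro hl
  have hne : ∀ i, e i ≠ P := fun i h => heZ i (h ▸ hP)
  -- Going from `P` to `e i` along `c i`, then along `l`, then from `e j` back along `c j` gives an
  -- excursion through both errant nodes, whereas each `c k` misses one of them.
  obtain ⟨x, y, -, hx, hy, hey⟩ := excursions_split (hc i) (hce i) (hne i)
  obtain ⟨x', y', -, hx', hy', hey'⟩ := excursions_split (hc j) (hce j) (hne j)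
  obtain ⟨k, hk⟩ := hall _ (excursions_append (excursions_append hx hl) hy')
  have hj : e j ∈ (c k).map D.src := by
    rw [← hk, List.map_append]
    exact List.mem_append_right _ hey'
  have hi : e i ∈ (c k).map D.src := by
    rw [← hk, List.map_append, List.map_append]
    cases l with
    | nil =>
      rw [show e i = e j from hl.1]
      exact List.mem_append_right _ hey'
    | cons a l =>
      refine List.mem_append_left _ (List.mem_append_right _ ?_)
      rw [List.map_cons, hl.1.1]
      exact List.mem_cons_self
  by_cases hki : k = i
  · subst hki
    exact hcn _ _ hij hj
  · exact hcn _ _ hki hi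

/-- The part of the excursion between the two errant nodes would be a free path linking them, in one
direction or the other. -/
theorem not_mem_of_mem_errant (heZ : ∀ i, e i ∉ Z)
    (hlink : ∀ i j, i ≠ j → ∀ l, l ∉ D.freePaths Z F (e i) (e j)) {u v : V} (hu : u ∈ Z)
    {s : List A} (hs : s ∈ D.excursions Z F u v) {i j : Fin 2} (hij : i ≠ j)
    (hi : e i ∈ s.map D.src) : e j ∉ s.map D.src := by
  intro hj
  obtain ⟨x, y, rfl, hx, hy, hey⟩ := excursions_split hs hi (fun h => heZ i (h ▸ hu))
  rw [List.map_append] at hj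
  rcases List.mem_append.1 hj with hj | hj
  · obtain ⟨-, y', -, -, h, -⟩ := excursions_split hx hj (fun h => heZ j (h ▸ hu))
    exact hlink _ _ hij.symm _ h
  · obtain ⟨x', -, -, h, -⟩ := freePaths_split hy hj
    exact hlink _ _ hij _ h

/-- A node that lies on an excursion from `u` to `v` and on one from `u'` to `v'` lies on one
from `u` to `v'`. -/
theorem exists_mem_excursions_of_common {u v u' v' x : V} {s s' : List A}
    (hs : s ∈ D.excursions Z F u v) (hs' : s' ∈ D.excursions Z F u' v') (hu : x ≠ u)
    (hu' : x ≠ u') (hx : x ∈ s.map D.src) (hx' : x ∈ s'.map D.src) :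
    ∃ t ∈ D.excursions Z F u v', x ∈ t.map D.src := by
  obtain ⟨l, -, -, hl, -⟩ := excursions_split hs hx hu
  obtain ⟨-, r, -, -, hr, hxr⟩ := excursions_split hs' hx' hu'
  exact ⟨_, excursions_append hl hr, by
    rw [List.map_append]; exact List.mem_append_right _ hxr⟩

end Links

/-- If a product of two sets is covered by two pairs whose second components differ, then the
first set is a singleton. -/
theorem singleton_pair_of_cover {α β : Type*} {S : Set α} {S' : Set β} {p : Fin 2 → α}
    {q : Fin 2 → β} (hp : ∀ i, p i ∈ S) (hq : ∀ i, q i ∈ S')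
    (h : ∀ a ∈ S, ∀ b ∈ S', ∃ i, a = p i ∧ b = q i) (hne : q 0 ≠ q 1) :
    p 1 = p 0 ∧ S = {p 0} ∧ S' = {q 0, q 1} := by
  have h1 : ∀ a ∈ S, a = p 0 := by
    intro a ha
    -- Pairing `a` with `q 0` forces the index 0, since `q 1` differs from `q 0`.
    obtain ⟨i, h1, h2⟩ := h a ha (q 0) (hq 0)
    rcases Fin.exists_fin_two.1 ⟨i, rfl⟩ with rfl | rfl
    · exact h1
    · exact absurd h2 hne
  refine ⟨h1 _ (hp 1), Set.Subset.antisymm h1 ?_, Set.Subset.antisymm ?_ ?_⟩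
  · rintro _ rfl
    exact hp 0
  · intro b hb
    obtain ⟨i, -, h2⟩ := h (p 0) (hp 0) b hb
    rcases Fin.exists_fin_two.1 ⟨i, rfl⟩ with rfl | rfl
    · exact Or.inl h2
    · exact Or.inr h2
  · rintro _ (rfl | rfl)
    · exact hq 0
    · exact hq 1

/-! ### The linear system for the walk counts -/

section LinearSystem

variable {R M : Type*} [CommRing R] [AddCommGroup M] [Module R M]

/-- Elimination of `X` when the errant loops are visited after the pseudo-common node. -/
theorem eliminate_after {B X δ : M} {t₂ t₃ c₀ c₁ o p q₀ q₁ : R}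
    (hB : ((1 - t₂) * (1 - t₃)) • B = ((1 - t₂) * (1 - t₃)) • δ + (o * ((1 - t₂) * (1 - t₃))) • B
      + (p * ((1 - t₂) * (1 - t₃))) • X)
    (hX : ((1 - t₂) * (1 - t₃)) • X = (q₀ * (1 - t₃) + q₁ * (1 - t₂)) • B
      + (c₀ * (1 - t₃) + c₁ * (1 - t₂)) • X) :
    ((1 - t₂) * (1 - t₃)) • ((1 - c₀ - c₁ - t₂ - t₃ + c₀ * t₃ + c₁ * t₂ + t₂ * t₃) • B) =
    ((1 - t₂) * (1 - t₃)) • ((1 - c₀ - c₁ - t₂ - t₃ + c₀ * t₃ + c₁ * t₂ + t₂ * t₃) • (δ + o • B)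
      + (p * q₀ * (1 - t₃) + p * q₁ * (1 - t₂)) • B) := by
  -- The coefficient of `hB` is (1 - t₂)(1 - t₃) - c₀(1 - t₃) - c₁(1 - t₂), by which `hX` expresses
  -- `X` through `B`.
  linear_combination (norm := module)
    (1 - c₀ - c₁ - t₂ - t₃ + c₀ * t₃ + c₁ * t₂ + t₂ * t₃) • hB
      + (p * ((1 - t₂) * (1 - t₃))) • hX

/-- Elimination of `X` when the errant loops are visited before the pseudo-common node. -/
theorem eliminate_before {B X δ : M} {t₂ t₃ c₀ c₁ o q p₀ p₁ : R}
    (hB : ((1 - t₂) * (1 - t₃)) • B = ((1 - t₂) * (1 - t₃)) • δ + (o * ((1 - t₂) * (1 - t₃))) • B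
      + (p₀ * (1 - t₃) + p₁ * (1 - t₂)) • X)
    (hX : ((1 - t₂) * (1 - t₃)) • X = (q * ((1 - t₂) * (1 - t₃))) • B
      + (c₀ * (1 - t₃) + c₁ * (1 - t₂)) • X) :
    ((1 - t₂) * (1 - t₃)) • ((1 - c₀ - c₁ - t₂ - t₃ + c₀ * t₃ + c₁ * t₂ + t₂ * t₃) • B) =
    ((1 - t₂) * (1 - t₃)) • ((1 - c₀ - c₁ - t₂ - t₃ + c₀ * t₃ + c₁ * t₂ + t₂ * t₃) • (δ + o • B)
      + (p₀ * q * (1 - t₃) + p₁ * q * (1 - t₂)) • B) := by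
  linear_combination (norm := module)
    (1 - c₀ - c₁ - t₂ - t₃ + c₀ * t₃ + c₁ * t₂ + t₂ * t₃) • hB
      + (p₀ * (1 - t₃) + p₁ * (1 - t₂)) • hX

end LinearSystem

/-! ### Values of the factors and sums -/

section Sums

variable {E : Fin 2 → A} {c : ℤ}

theorem missedFactor_nil : missedFactor D E c [] =
    (1 - T (D.arcWeight c (E 0))) * (1 - T (D.arcWeight c (E 1))) := by
  simp [missedFactor, Fin.prod_univ_two]

theorem missedFactor_of_not_mem {s : List A} (h : ∀ i, D.src (E i) ∉ s.map D.src) :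
    missedFactor D E c s = missedFactor D E c [] := by
  rw [missedFactor_nil, missedFactor, Fin.prod_univ_two, if_neg (h 0), if_neg (h 1)]

theorem missedFactor_zero {s : List A} (h : D.src (E 0) ∈ s.map D.src)
    (h' : D.src (E 1) ∉ s.map D.src) :
    missedFactor D E c s = 1 - T (D.arcWeight c (E 1)) := by
  rw [missedFactor, Fin.prod_univ_two, if_pos h, if_neg h', one_mul]

theorem missedFactor_one {s : List A} (h : D.src (E 0) ∉ s.map D.src)
    (h' : D.src (E 1) ∈ s.map D.src) :
    missedFactor D E c s = 1 - T (D.arcWeight c (E 0)) := by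
  rw [missedFactor, Fin.prod_univ_two, if_neg h, if_pos h', mul_one]

/-- The sum over a pair of excursions, each of which visits its own errant loop only. -/
theorem finsum_pair {S : Set (List A)} {s : Fin 2 → List A} (hS : S = {s 0, s 1})
    (h : ∀ i, D.src (E i) ∈ (s i).map D.src)
    (h' : ∀ i j, i ≠ j → D.src (E j) ∉ (s i).map D.src) (X : ShiftFun) :
    ∑ᶠ l ∈ S, (T (D.weight c l) * missedFactor D E c l) • X =
      (T (D.weight c (s 0)) * (1 - T (D.arcWeight c (E 1))) +
        T (D.weight c (s 1)) * (1 - T (D.arcWeight c (E 0)))) • X := by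
  have hne : s 0 ≠ s 1 := fun hs => h' 0 1 (by decide) (hs ▸ h 1)
  rw [hS, finsum_mem_pair hne, missedFactor_zero (h 0) (h' 0 1 (by decide)),
    missedFactor_one (h' 1 0 (by decide)) (h 1), add_smul]

theorem finsum_single {S : Set (List A)} {s : List A} (hS : S = {s})
    (h : ∀ i, D.src (E i) ∉ s.map D.src) (X : ShiftFun) :
    ∑ᶠ l ∈ S, (T (D.weight c l) * missedFactor D E c l) • X =
      (T (D.weight c s) *
        ((1 - T (D.arcWeight c (E 0))) * (1 - T (D.arcWeight c (E 1))))) • X := by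
  rw [hS, finsum_mem_singleton, missedFactor_of_not_mem h, missedFactor_nil]

theorem finsum_range {N : ℕ} {S : Set (List A)} {s : Fin N → List A} (hS : S = Set.range s)
    (hs : Function.Injective s) (h : ∀ k i, D.src (E i) ∉ (s k).map D.src) (X : ShiftFun) :
    ∑ᶠ l ∈ S, (T (D.weight c l) * missedFactor D E c l) • X =
      ((∑ k, T (D.weight c (s k))) *
        ((1 - T (D.arcWeight c (E 0))) * (1 - T (D.arcWeight c (E 1))))) • X := by
  rw [hS, finsum_mem_range hs, finsum_eq_sum_of_fintype, Finset.sum_mul, Finset.sum_smul]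
  exact Finset.sum_congr rfl fun k _ => by rw [missedFactor_of_not_mem (h k), missedFactor_nil]

end Sums

end TileDigraph

/-! ### The recurrence as an operator identity -/

namespace TileDigraph

open ShiftFun

variable {V A : Type*} {D : TileDigraph V A}

/-- The weight of a collection of arcs. -/
def multisetWeight (D : TileDigraph V A) (c : ℤ) (m : Multiset A) : ℤ × ℤ :=
  (D.len m, c * D.combs m)

theorem isInnerCycle_singleton {a : A} (h : D.IsInnerCycle (([a] : List A) : Cycle A)) :
    D.src a = D.tgt a ∧ D.src a ≠ D.zero := by
  obtain ⟨h1, h2⟩ := h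
  rw [isCycle_coe_cons] at h1
  rw [onCycle_coe] at h2
  exact ⟨h1.1.2.symm, fun h => h2 (by simp [h])⟩

/-- The recurrence for the walk counts, as an identity between elements of a module over shift
operators. -/
theorem walkCount_recurrence [Finite V] [Finite A]
    (hpos : ∀ c : Cycle A, D.IsCycle c → 0 < D.len c.toMultiset)
    {P : V} {E : Fin 2 → A} (hE : D.IsErrantFamily P (Set.range E))
    (C : Fin 4 ≃ {c : Cycle A // D.IsInnerCycle c})
    (hC2 : (C 2 : Cycle A) = (([E 0] : List A) : Cycle A))
    (hC3 : (C 3 : Cycle A) = (([E 1] : List A) : Cycle A))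
    (hatt0 : D.OnCycle (D.src (E 0)) (C 0)) (hatt1 : D.OnCycle (D.src (E 1)) (C 1))
    (cc : Fin 2 ≃ {w : List A × List A // D.IsCommonCircuit P w})
    (hcc : (∀ i, D.src (E i) ∈ D.visited P (cc i).1.2 ∧
              D.src (E i) ∉ D.visited D.zero (cc i).1.1) ∨
           (∀ i, D.src (E i) ∈ D.visited D.zero (cc i).1.1 ∧
              D.src (E i) ∉ D.visited P (cc i).1.2))
    {No : ℕ} (o : Fin No ≃ {c : Cycle A // D.IsOuterCycle P c}) (c : ℤ)
    {t : Fin 4 → AddMonoidAlgebra ℤ (ℤ × ℤ)}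
    (ht : ∀ r, t r = T (D.multisetWeight c (C r : Cycle A).toMultiset)) :
    (1 - t 0 - t 1 - t 2 - t 3 + t 0 * t 3 + t 1 * t 2 + t 2 * t 3) • D.walkCount c D.zero =
    (1 - t 0 - t 1 - t 2 - t 3 + t 0 * t 3 + t 1 * t 2 + t 2 * t 3) •
        (delta + (∑ i, T (D.multisetWeight c (o i : Cycle A).toMultiset)) •
          D.walkCount c D.zero) +
      (T (D.weight c ((cc 0).1.1 ++ (cc 0).1.2)) * (1 - t 3) +
        T (D.weight c ((cc 1).1.1 ++ (cc 1).1.2)) * (1 - t 2)) • D.walkCount c D.zero := by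
  obtain ⟨-, hEinner, hcommon, hmin⟩ := hE
  have hloop : ∀ i, D.src (E i) = D.tgt (E i) := fun i =>
    (isInnerCycle_singleton (hEinner _ ⟨i, rfl⟩)).1
  have he0 : ∀ i, D.src (E i) ≠ D.zero := fun i =>
    (isInnerCycle_singleton (hEinner _ ⟨i, rfl⟩)).2
  have hCinj : ∀ {r s : Fin 4}, r ≠ s → (C r : Cycle A) ≠ C s := fun h h' =>
    h (C.injective (Subtype.ext h'))
  have hmemC : ∀ (r : Fin 4) (a : A), a ∈ (C r : Cycle A) → D.src a = D.tgt a →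
      (C r : Cycle A) = (([a] : List A) : Cycle A) := fun r a ha hl =>
    eq_singleton_of_loop_mem (C r).2.1 ha hl
  have hfree : ∀ r : Fin 4, r ≠ 2 → r ≠ 3 → ∀ a ∈ (C r : Cycle A), a ∉ Set.range E := by
    rintro r h2 h3 _ ha ⟨i, rfl⟩
    have h := hmemC r _ ha (hloop i)
    rcases Fin.exists_fin_two.1 ⟨i, rfl⟩ with rfl | rfl
    · exact hCinj h2 (h.trans hC2.symm)
    · exact hCinj h3 (h.trans hC3.symm)
  have hEne : E 0 ≠ E 1 := fun h => hCinj (show (2 : Fin 4) ≠ 3 by decide) (by rw [hC2, hC3, h])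
  have hPC : ∀ r : Fin 4, r ≠ 2 → r ≠ 3 → D.OnCycle P (C r) := fun r h2 h3 =>
    hcommon _ (C r).2 (hfree r h2 h3)
  have hP0 : D.zero ≠ P := fun h => (C 0).2.2 (h ▸ hPC 0 (by decide) (by decide))
  have hcases : ∀ x : Cycle A, D.IsInnerCycle x →
      x = C 0 ∨ x = C 1 ∨ x = (([E 0] : List A) : Cycle A) ∨
        x = (([E 1] : List A) : Cycle A) := by
    intro x hx
    obtain ⟨r, hr⟩ := C.surjective ⟨x, hx⟩
    have hx' : x = C r := by rw [hr]
    rw [← hC2, ← hC3, hx']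
    fin_cases r <;> simp
  -- Otherwise deleting only the loop `E 0` would already make the node of `E 1` common to all
  -- remaining inner cycles, against minimality of the errant family.
  have hcross0 : ¬ D.OnCycle (D.src (E 1)) (C 0) := by
    intro h
    refine hmin {E 0} ⟨by simp, fun hs => hEne.symm (hs ⟨1, rfl⟩)⟩ (D.src (E 1)) ?_
    intro x hx hxE
    rcases hcases x hx with rfl | rfl | rfl | rfl
    · exact h
    · exact hatt1
    · exact absurd rfl (hxE (E 0) (by simp))
    · simp [onCycle_coe]
  have hcross1 : ¬ D.OnCycle (D.src (E 0)) (C 1) := by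
    intro h
    refine hmin {E 1} ⟨by simp, fun hs => hEne (hs ⟨0, rfl⟩)⟩ (D.src (E 0)) ?_
    intro x hx hxE
    rcases hcases x hx with rfl | rfl | rfl | rfl
    · exact hatt0
    · exact h
    · simp [onCycle_coe]
    · exact absurd rfl (hxE (E 1) (by simp))
  -- `P` lies on both `C 0` and `C 1`, while each errant node misses one of them.
  have heP : ∀ i, D.src (E i) ≠ P := by
    intro i h
    rcases Fin.exists_fin_two.1 ⟨i, rfl⟩ with rfl | rfl
    · exact hcross1 (h ▸ hPC 1 (by decide) (by decide))
    · exact hcross0 (h ▸ hPC 0 (by decide) (by decide))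
  have hinj : Function.Injective fun i => D.src (E i) := by
    have hne : D.src (E 0) ≠ D.src (E 1) := fun h => hcross0 (h ▸ hatt0)
    intro i j h
    rcases Fin.exists_fin_two.1 ⟨i, rfl⟩ with rfl | rfl <;>
      rcases Fin.exists_fin_two.1 ⟨j, rfl⟩ with rfl | rfl
    · rfl
    · exact absurd h hne
    · exact absurd h.symm hne
    · rfl
  have hZ : ∀ i, D.src (E i) ∉ ({D.zero, P} : Set V) := by
    rintro i (h | h)
    · exact he0 i h
    · exact heP i h
  have hF : ∀ a ∈ Set.range E, D.src a = D.tgt a ∧ D.src a ∉ ({D.zero, P} : Set V) := by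
    rintro _ ⟨i, rfl⟩
    exact ⟨hloop i, hZ i⟩
  have hac : ∀ x : Cycle A, D.IsCycle x → (∀ a ∈ x, a ∉ Set.range E) →
      ∃ v ∈ ({D.zero, P} : Set V), D.OnCycle v x := by
    intro x hx hxE
    by_cases h : D.OnCycle D.zero x
    · exact ⟨_, by simp, h⟩
    · exact ⟨P, by simp, hcommon x ⟨hx, h⟩ hxE⟩
  have hzZ : D.zero ∈ ({D.zero, P} : Set V) := by simp
  have hPZ : P ∈ ({D.zero, P} : Set V) := by simp
  -- the two inner cycles through `P`, as closed walks
  have hCw : ∀ r : Fin 4, r ≠ 2 → r ≠ 3 →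
      ∃ s ∈ D.excursions {D.zero, P} (Set.range E) P P, (s : Cycle A) = C r := by
    intro r h2 h3
    refine exists_mem_excursions hF hPZ (C r).2.1 (hPC r h2 h3) ?_
    rintro v (rfl | rfl) hv
    · exact absurd hv (C r).2.2
    · rfl
  obtain ⟨s₀, hs₀, hs₀C⟩ := hCw 0 (by decide) (by decide)
  obtain ⟨s₁, hs₁, hs₁C⟩ := hCw 1 (by decide) (by decide)
  let s : Fin 2 → List A := ![s₀, s₁]
  have hs : ∀ i, s i ∈ D.excursions {D.zero, P} (Set.range E) P P :=
    Fin.forall_fin_two.2 ⟨hs₀, hs₁⟩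
  have hse : ∀ i, D.src (E i) ∈ (s i).map D.src := by
    refine Fin.forall_fin_two.2 ⟨?_, ?_⟩
    · rw [← onCycle_coe]; exact hs₀C ▸ hatt0
    · rw [← onCycle_coe]; exact hs₁C ▸ hatt1
  have hsn : ∀ i j, i ≠ j → D.src (E j) ∉ (s i).map D.src := by
    intro i j hij
    rcases Fin.exists_fin_two.1 ⟨i, rfl⟩ with rfl | rfl <;>
      rcases Fin.exists_fin_two.1 ⟨j, rfl⟩ with rfl | rfl
    · exact absurd rfl hij
    · rw [← onCycle_coe]; exact hs₀C ▸ hcross0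
    · rw [← onCycle_coe]; exact hs₁C ▸ hcross1
    · exact absurd rfl hij
  -- An excursion from `P` to `P` avoids the 0 node, so it is an inner cycle; the errant loops are
  -- excluded because they miss `P`.
  have hsall : ∀ l ∈ D.excursions {D.zero, P} (Set.range E) P P, ∃ i, l = s i := by
    intro l hl
    have hlc := isCycle_of_mem_excursions hac hPZ hl
    have hl0 : ¬ D.OnCycle D.zero (l : Cycle A) := fun h =>
      hP0 (eq_of_mem_excursions hl hzZ ((D.onCycle_coe).1 h))
    have hlP : D.OnCycle P (l : Cycle A) := (D.onCycle_coe).2 (start_mem_of_mem_excursions hl)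
    rcases hcases _ ⟨hlc, hl0⟩ with h | h | h | h
    · exact ⟨0, coe_injOn_excursions hac hPZ hl hs₀ (h.trans hs₀C.symm)⟩
    · exact ⟨1, coe_injOn_excursions hac hPZ hl hs₁ (h.trans hs₁C.symm)⟩
    · rw [h, onCycle_coe] at hlP
      exact absurd (List.mem_singleton.1 hlP).symm (heP 0)
    · rw [h, onCycle_coe] at hlP
      exact absurd (List.mem_singleton.1 hlP).symm (heP 1)
  have hSS : D.excursions {D.zero, P} (Set.range E) P P = {s 0, s 1} := by
    ext l
    refine ⟨fun hl => ?_, ?_⟩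
    · obtain ⟨i, rfl⟩ := hsall l hl
      rcases Fin.exists_fin_two.1 ⟨i, rfl⟩ with rfl | rfl
      · exact Or.inl rfl
      · exact Or.inr rfl
    · rintro (rfl | rfl)
      · exact hs 0
      · exact hs 1
  have hlink : ∀ i j, i ≠ j → ∀ l,
      l ∉ D.freePaths {D.zero, P} (Set.range E) (D.src (E i)) (D.src (E j)) :=
    fun i j hij l => not_mem_freePaths_errant (e := fun i => D.src (E i)) hPZ hZ hs hse hsn hsall
      hij l
  have hsep : ∀ {u v : V} {l : List A}, u ∈ ({D.zero, P} : Set V) →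
      l ∈ D.excursions {D.zero, P} (Set.range E) u v → ∀ i j, i ≠ j →
      D.src (E i) ∈ l.map D.src → D.src (E j) ∉ l.map D.src :=
    fun hu hl i j hij hi =>
      not_mem_of_mem_errant (e := fun i => D.src (E i)) hZ hlink hu hl hij hi
  -- the outer cycles, as closed walks
  have how : ∀ k, ∃ l ∈ D.excursions {D.zero, P} (Set.range E) D.zero D.zero,
      (l : Cycle A) = o k := by
    intro k
    refine exists_mem_excursions hF hzZ (o k).2.1 (o k).2.2.1 ?_
    rintro v (rfl | rfl) hv
    · rfl
    · exact absurd hv (o k).2.2.2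
  choose ol hol holc using how
  have holinj : Function.Injective ol := fun k k' h =>
    o.injective (Subtype.ext (by rw [← holc, ← holc, h]))
  have hOO : D.excursions {D.zero, P} (Set.range E) D.zero D.zero = Set.range ol := by
    ext l
    constructor
    · intro hl
      obtain ⟨k, hk⟩ := o.surjective ⟨(l : Cycle A), isCycle_of_mem_excursions hac hzZ hl,
        (D.onCycle_coe).2 (start_mem_of_mem_excursions hl),
        fun h => hP0 (eq_of_mem_excursions hl hPZ ((D.onCycle_coe).1 h)).symm⟩
      exact ⟨k, coe_injOn_excursions hac hzZ (hol k) hl ((holc k).trans (by rw [hk]))⟩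
    · rintro ⟨k, rfl⟩
      exact hol k
  -- the common circuits
  have h0P : ∀ {l : List A}, l ∈ D.excursions {D.zero, P} (Set.range E) D.zero P ↔
      D.IsSimplePath D.zero P l :=
    mem_excursions_iff_isSimplePath hac (fun a ha => (hF a ha).1) hP0 (fun w => Iff.rfl)
  have hP0' : ∀ {l : List A}, l ∈ D.excursions {D.zero, P} (Set.range E) P D.zero ↔
      D.IsSimplePath P D.zero l :=
    mem_excursions_iff_isSimplePath hac (fun a ha => (hF a ha).1) hP0.symm (fun w => or_comm)
  let p : Fin 2 → List A := fun i => (cc i).1.1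
  let q : Fin 2 → List A := fun i => (cc i).1.2
  have hp : ∀ i, p i ∈ D.excursions {D.zero, P} (Set.range E) D.zero P := fun i =>
    h0P.2 (cc i).2.1
  have hq : ∀ i, q i ∈ D.excursions {D.zero, P} (Set.range E) P D.zero := fun i =>
    hP0'.2 (cc i).2.2
  have hcover : ∀ a ∈ D.excursions {D.zero, P} (Set.range E) D.zero P,
      ∀ b ∈ D.excursions {D.zero, P} (Set.range E) P D.zero, ∃ i, a = p i ∧ b = q i := by
    intro a ha b hb
    obtain ⟨i, hi⟩ := cc.surjective ⟨(a, b), h0P.1 ha, hP0'.1 hb⟩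
    exact ⟨i, by simp [p, hi], by simp [q, hi]⟩
  have hvp : ∀ i j, D.src (E j) ∈ D.visited D.zero (p i) ↔ D.src (E j) ∈ (p i).map D.src := by
    intro i j
    rw [(isWalk_of_mem_excursions (hp i)).visited_eq, List.mem_append, List.mem_singleton,
      or_iff_left (heP j)]
  have hvq : ∀ i j, D.src (E j) ∈ D.visited P (q i) ↔ D.src (E j) ∈ (q i).map D.src := by
    intro i j
    rw [(isWalk_of_mem_excursions (hq i)).visited_eq, List.mem_append, List.mem_singleton,
      or_iff_left (he0 j)]
  -- the linear system
  have hincr : ∀ i, 0 < D.incr (E i) := by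
    intro i
    have := hpos _ (hEinner _ ⟨i, rfl⟩).1
    simpa [len] using this
  have hB := missedFactor_smul_walkCount_of_mem hpos hP0 hac hloop hinj hincr hZ c hzZ
  have hX := missedFactor_smul_walkCount_of_mem hpos hP0 hac hloop hinj hincr hZ c hPZ
  rw [if_pos rfl] at hB
  rw [if_neg hP0.symm, smul_zero, zero_add] at hX
  rw [finsum_pair hSS hse hsn] at hX
  have ht0 : T (D.weight c (s 0)) = t 0 := by
    rw [ht, ← hs₀C, Cycle.coe_toMultiset]; rfl
  have ht1 : T (D.weight c (s 1)) = t 1 := by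
    rw [ht, ← hs₁C, Cycle.coe_toMultiset]; rfl
  have ht2 : T (D.arcWeight c (E 0)) = t 2 := by
    rw [ht, hC2, Cycle.coe_toMultiset]; simp [arcWeight, multisetWeight, len, combs]
  have ht3 : T (D.arcWeight c (E 1)) = t 3 := by
    rw [ht, hC3, Cycle.coe_toMultiset]; simp [arcWeight, multisetWeight, len, combs]
  have hto : ∀ k, T (D.multisetWeight c (o k : Cycle A).toMultiset) = T (D.weight c (ol k)) := by
    intro k
    rw [← holc, Cycle.coe_toMultiset]; rfl
  simp only [hto, weight_append, T_add]
  rw [ht0, ht1] at hX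
  -- Errant loops are cycles, so their lengths are positive and both factors can be cancelled.
  have hcancel : ∀ f g : ShiftFun, f ∈ boundedBelow → g ∈ boundedBelow →
      ((1 - t 2) * (1 - t 3)) • f = ((1 - t 2) * (1 - t 3)) • g → f = g := by
    intro f g hf hg h
    rw [mul_smul, mul_smul, ← ht2, ← ht3] at h
    have hE' : ∀ i, 0 < (D.arcWeight c (E i)).1 := fun i => by simpa [arcWeight] using hincr i
    exact eq_of_one_sub_T_smul (hE' 1) hf hg (eq_of_one_sub_T_smul (hE' 0)
      (boundedBelow.smul_mem _ hf) (boundedBelow.smul_mem _ hg) h)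
  have hXm := D.walkCount_mem c D.zero
  refine hcancel _ _ (boundedBelow.smul_mem _ hXm) (boundedBelow.add_mem
    (boundedBelow.smul_mem _ (boundedBelow.add_mem delta_mem (boundedBelow.smul_mem _ hXm)))
    (boundedBelow.smul_mem _ hXm)) ?_
  rcases hcc with hcc | hcc
  · have hqe : ∀ i, D.src (E i) ∈ (q i).map D.src := fun i => (hvq i i).1 (hcc i).1
    have hqn : ∀ i j, i ≠ j → D.src (E j) ∉ (q i).map D.src := fun i j hij =>
      hsep hPZ (hq i) i j hij (hqe i)
    -- The second paths differ because they meet different errant nodes; as the circuits form a full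
    -- product, the first paths must coincide.
    have hne : q 0 ≠ q 1 := fun h => hqn 0 1 (by decide) (h ▸ hqe 1)
    obtain ⟨hp1, hSp, hSq⟩ := singleton_pair_of_cover hp hq hcover hne
    have hpe : ∀ i, D.src (E i) ∉ (p 0).map D.src := by
      refine Fin.forall_fin_two.2 ⟨fun h => (hcc 0).2 ((hvp 0 0).2 h), fun h => ?_⟩
      exact (hcc 1).2 ((hvp 1 1).2 (hp1 ▸ h))
    -- An outer cycle through an errant node, followed up to that node and continued along the inner
    -- cycle to `P`, would be a path from the 0 node to `P` through it; the only such path, `p 0`,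
    -- misses it.
    have hoe : ∀ k i, D.src (E i) ∉ (ol k).map D.src := by
      intro k i h
      obtain ⟨l, hl, hle⟩ :=
        exists_mem_excursions_of_common (hol k) (hs i) (he0 i) (heP i) h (hse i)
      rw [hSp] at hl
      rw [show l = p 0 from hl] at hle
      exact hpe i hle
    rw [finsum_range hOO holinj hoe, finsum_single hSp hpe, missedFactor_nil, ht2, ht3] at hB
    rw [finsum_pair hSq hqe hqn, missedFactor_nil, ht2, ht3] at hX
    rw [show (cc 1).1.1 = p 0 from hp1]
    exact eliminate_after hB hX
  · have hpe : ∀ i, D.src (E i) ∈ (p i).map D.src := fun i => (hvp i i).1 (hcc i).1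
    have hpn : ∀ i j, i ≠ j → D.src (E j) ∉ (p i).map D.src := fun i j hij =>
      hsep hzZ (hp i) i j hij (hpe i)
    have hne : p 0 ≠ p 1 := fun h => hpn 0 1 (by decide) (h ▸ hpe 1)
    obtain ⟨hq1, hSq, hSp⟩ := singleton_pair_of_cover hq hp
      (fun b hb a ha => (hcover a ha b hb).imp fun _ h => h.symm) hne
    have hqe : ∀ i, D.src (E i) ∉ (q 0).map D.src := by
      refine Fin.forall_fin_two.2 ⟨fun h => (hcc 0).2 ((hvq 0 0).2 h), fun h => ?_⟩
      exact (hcc 1).2 ((hvq 1 1).2 (hq1 ▸ h))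
    -- The mirror image: the inner cycle from `P` to the errant node, then the outer cycle to the 0
    -- node.
    have hoe : ∀ k i, D.src (E i) ∉ (ol k).map D.src := by
      intro k i h
      obtain ⟨l, hl, hle⟩ :=
        exists_mem_excursions_of_common (hs i) (hol k) (heP i) (he0 i) (hse i) h
      rw [hSq] at hl
      rw [show l = q 0 from hl] at hle
      exact hqe i hle
    rw [finsum_range hOO holinj hoe, finsum_pair hSp hpe hpn, missedFactor_nil, ht2, ht3] at hB
    rw [finsum_single hSq hqe, missedFactor_nil, ht2, ht3] at hX
    rw [show (cc 1).1.2 = q 0 from hq1]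
    exact eliminate_before hB hX

end TileDigraph

/-! ### Completing a partially filled board -/

/-- `Completes Q s n T`: the tiling `T` completes the `n`-board whose cells in `s` are already
filled; the leftmost cells of the tiles of `T` avoid the filled cells. -/
structure Completes (Q s : Finset ℕ) (n : ℕ) (T : Finset ℕ × Finset ℕ) : Prop where
  filled_lt : ∀ x ∈ s, x < n
  comb_lt : ∀ c ∈ T.1, ∀ x ∈ combCells Q, c + x < n
  square_lt : ∀ t ∈ T.2, t < n
  comb_not_mem : ∀ c ∈ T.1, c ∉ s
  square_not_mem : ∀ t ∈ T.2, t ∉ s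
  comb_comb : ∀ c ∈ T.1, ∀ c' ∈ T.1, c ≠ c' → ∀ x ∈ combCells Q, c ≠ c' + x
  square_comb : ∀ t ∈ T.2, ∀ c ∈ T.1, ∀ x ∈ combCells Q, t ≠ c + x
  cover : ∀ i < n, i ∈ s ∨ i ∈ T.2 ∨ ∃ c ∈ T.1, ∃ x ∈ combCells Q, i = c + x

theorem isTiling_iff_completes {Q : Finset ℕ} {n : ℕ} {T : Finset ℕ × Finset ℕ} :
    IsTiling Q n T ↔ Completes Q ∅ n T := by
  constructor
  · rintro ⟨h1, h2, h3, h4, h5⟩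
    exact ⟨by simp, h1, h2, by simp, by simp, h3, h4, fun i hi => Or.inr (h5 i hi)⟩
  · rintro ⟨-, h1, h2, -, -, h3, h4, h5⟩
    exact ⟨h1, h2, h3, h4, fun i hi => (h5 i hi).resolve_left (by simp)⟩

theorem zero_mem_combCells (Q : Finset ℕ) : 0 ∈ combCells Q := Finset.mem_insert_self _ _

theorem finite_completes (Q s : Finset ℕ) (n : ℕ) : {T | Completes Q s n T}.Finite := by
  refine ((Finset.range n).powerset ×ˢ (Finset.range n).powerset).finite_toSet.subset ?_
  intro T hT
  simp only [Finset.coe_product, Set.mem_prod, Finset.mem_coe, Finset.mem_powerset]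
  exact ⟨fun c hc => Finset.mem_range.2 (hT.comb_lt c hc 0 (zero_mem_combCells Q)),
    fun t ht => Finset.mem_range.2 (hT.square_lt t ht)⟩

/-- Add a tile whose leftmost cell is cell 0. -/
def addTile (t : Tile) (T : Finset ℕ × Finset ℕ) : Finset ℕ × Finset ℕ :=
  match t with
  | .square => (T.1, insert 0 T.2)
  | .comb => (insert 0 T.1, T.2)

theorem zero_mem_placeTile (Q s : Finset ℕ) (t : Tile) : 0 ∈ placeTile Q s t := by
  cases t <;> simp [placeTile, tileCells, combCells]

theorem Completes.zero_not_mem {Q s : Finset ℕ} {n : ℕ} {T : Finset ℕ × Finset ℕ}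
    (h : Completes Q s n T) (h0 : 0 ∈ s) : 0 ∉ T.1 ∧ 0 ∉ T.2 :=
  ⟨fun h1 => h.comb_not_mem 0 h1 h0, fun h1 => h.square_not_mem 0 h1 h0⟩

/-- Overlap is forbidden only at leftmost cells, so a tile placed at cell 0 constrains the later
ones only through the cells that it fills. -/
theorem completes_addTile {Q s : Finset ℕ} {n : ℕ} (hn : 0 < n) (hs : 0 ∉ s) (t : Tile)
    {T : Finset ℕ × Finset ℕ} (h1 : 0 ∉ T.1) (h2 : 0 ∉ T.2) :
    Completes Q s n (addTile t T) ↔ Completes Q (placeTile Q s t) n T := by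
  obtain ⟨T₁, T₂⟩ := T
  have hc0 : ∀ c ∈ T₁, c ≠ 0 := fun c hc h => h1 (h ▸ hc)
  have ht0 : ∀ c ∈ T₂, c ≠ 0 := fun c hc h => h2 (h ▸ hc)
  cases t with
  | square =>
    simp only [addTile, placeTile, tileCells]
    constructor
    · rintro ⟨a1, a2, a3, a4, a5, a6, a7, a8⟩
      simp only [Finset.forall_mem_insert] at a3 a5 a7
      refine ⟨?_, a2, a3.2, ?_, ?_, a6, a7.2, ?_⟩
      · intro x hx
        rcases Finset.mem_union.1 hx with hx | hx
        · exact a1 x hx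
        · rw [Finset.mem_singleton.1 hx]; exact hn
      · intro c hc h
        rcases Finset.mem_union.1 h with h | h
        · exact a4 c hc h
        · exact hc0 c hc (Finset.mem_singleton.1 h)
      · intro c hc h
        rcases Finset.mem_union.1 h with h | h
        · exact a5.2 c hc h
        · exact ht0 c hc (Finset.mem_singleton.1 h)
      · intro i hi
        rcases a8 i hi with h | h | h
        · exact Or.inl (Finset.mem_union_left _ h)
        · rcases Finset.mem_insert.1 h with h | h
          · exact Or.inl (Finset.mem_union_right _ (by simp [h]))
          · exact Or.inr (Or.inl h)
        · exact Or.inr (Or.inr h)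
    · rintro ⟨a1, a2, a3, a4, a5, a6, a7, a8⟩
      refine ⟨fun x hx => a1 x (Finset.mem_union_left _ hx), a2, ?_,
        fun c hc h => a4 c hc (Finset.mem_union_left _ h), ?_, a6, ?_, ?_⟩
      · exact Finset.forall_mem_insert _ _ _ |>.2 ⟨hn, a3⟩
      · exact Finset.forall_mem_insert _ _ _ |>.2
          ⟨hs, fun c hc h => a5 c hc (Finset.mem_union_left _ h)⟩
      · refine Finset.forall_mem_insert _ _ _ |>.2 ⟨fun c hc x _ h => ?_, a7⟩
        have := hc0 c hc
        omega
      · intro i hi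
        rcases a8 i hi with h | h | h
        · rcases Finset.mem_union.1 h with h | h
          · exact Or.inl h
          · exact Or.inr (Or.inl (Finset.mem_insert.2 (Or.inl (Finset.mem_singleton.1 h))))
        · exact Or.inr (Or.inl (Finset.mem_insert_of_mem h))
        · exact Or.inr (Or.inr h)
  | comb =>
    simp only [addTile, placeTile, tileCells]
    constructor
    · rintro ⟨a1, a2, a3, a4, a5, a6, a7, a8⟩
      refine ⟨?_, fun c hc => a2 c (Finset.mem_insert_of_mem hc), a3, ?_, ?_,
        fun c hc c' hc' => a6 c (Finset.mem_insert_of_mem hc) c' (Finset.mem_insert_of_mem hc'),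
        fun t ht c hc => a7 t ht c (Finset.mem_insert_of_mem hc), ?_⟩
      · intro x hx
        rcases Finset.mem_union.1 hx with hx | hx
        · exact a1 x hx
        · simpa using a2 0 (Finset.mem_insert_self _ _) x hx
      · intro c hc h
        rcases Finset.mem_union.1 h with h | h
        · exact a4 c (Finset.mem_insert_of_mem hc) h
        · exact a6 c (Finset.mem_insert_of_mem hc) 0 (Finset.mem_insert_self _ _) (hc0 c hc) c h
            (zero_add c).symm
      · intro t ht h
        rcases Finset.mem_union.1 h with h | h
        · exact a5 t ht h
        · exact a7 t ht 0 (Finset.mem_insert_self _ _) t h (zero_add t).symm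
      · intro i hi
        rcases a8 i hi with h | h | ⟨c, hc, x, hx, h⟩
        · exact Or.inl (Finset.mem_union_left _ h)
        · exact Or.inr (Or.inl h)
        · rcases Finset.mem_insert.1 hc with rfl | hc
          · rw [zero_add] at h
            exact Or.inl (Finset.mem_union_right _ (h ▸ hx))
          · exact Or.inr (Or.inr ⟨c, hc, x, hx, h⟩)
    · rintro ⟨a1, a2, a3, a4, a5, a6, a7, a8⟩
      refine ⟨fun x hx => a1 x (Finset.mem_union_left _ hx), ?_, a3, ?_,
        fun t ht h => a5 t ht (Finset.mem_union_left _ h), ?_, ?_, ?_⟩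
      · refine Finset.forall_mem_insert _ _ _ |>.2 ⟨fun x hx => ?_, a2⟩
        rw [zero_add]
        exact a1 x (Finset.mem_union_right _ hx)
      · exact Finset.forall_mem_insert _ _ _ |>.2
          ⟨hs, fun c hc h => a4 c hc (Finset.mem_union_left _ h)⟩
      · intro c hc c' hc' hne x hx h
        rcases Finset.mem_insert.1 hc with rfl | hc
        · rcases Finset.mem_insert.1 hc' with rfl | hc'
          · exact hne rfl
          · have := hc0 c' hc'
            omega
        · rcases Finset.mem_insert.1 hc' with rfl | hc'
          · rw [zero_add] at h
            exact a4 c hc (Finset.mem_union_right _ (h ▸ hx))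
          · exact a6 c hc c' hc' hne x hx h
      · intro t ht c hc x hx h
        rcases Finset.mem_insert.1 hc with rfl | hc
        · rw [zero_add] at h
          exact a5 t ht (Finset.mem_union_right _ (h ▸ hx))
        · exact a7 t ht c hc x hx h
      · intro i hi
        rcases a8 i hi with h | h | ⟨c, hc, h⟩
        · rcases Finset.mem_union.1 h with h | h
          · exact Or.inl h
          · exact Or.inr (Or.inr ⟨0, Finset.mem_insert_self _ _, i, h, (zero_add i).symm⟩)
        · exact Or.inr (Or.inl h)
        · exact Or.inr (Or.inr ⟨c, Finset.mem_insert_of_mem hc, h⟩)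

/-- The number of completions, by `c` times the number of combs. -/
noncomputable def completionCount (c : ℤ) (Q s : Finset ℕ) (n : ℕ) (κ : ℤ) : ℤ :=
  ({T | Completes Q s n T ∧ c * T.1.card = κ}.ncard : ℤ)

theorem completionCount_zero (c : ℤ) (Q s : Finset ℕ) (κ : ℤ) :
    completionCount c Q s 0 κ = if s = ∅ ∧ κ = 0 then 1 else 0 := by
  have h : ∀ T, Completes Q s 0 T ↔ s = ∅ ∧ T = (∅, ∅) := by
    intro T
    constructor
    · intro h
      refine ⟨Finset.eq_empty_of_forall_notMem fun x hx => absurd (h.filled_lt x hx) (by simp),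
        Prod.ext (Finset.eq_empty_of_forall_notMem fun x hx => ?_)
          (Finset.eq_empty_of_forall_notMem fun x hx => ?_)⟩
      · exact absurd (h.comb_lt x hx 0 (zero_mem_combCells Q)) (by simp)
      · exact absurd (h.square_lt x hx) (by simp)
    · rintro ⟨rfl, rfl⟩
      exact ⟨by simp, by simp, by simp, by simp, by simp, by simp, by simp, by simp⟩
  split_ifs with hs
  · obtain ⟨rfl, rfl⟩ := hs
    have : {T : Finset ℕ × Finset ℕ | Completes Q ∅ 0 T ∧ c * (T.1.card : ℤ) = 0} =
        {(∅, ∅)} := by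
      ext T
      constructor
      · exact fun hT => ((h T).1 hT.1).2
      · rintro rfl
        exact ⟨(h _).2 ⟨rfl, rfl⟩, by simp⟩
    rw [completionCount, this, Set.ncard_singleton, Nat.cast_one]
  · have : {T : Finset ℕ × Finset ℕ | Completes Q s 0 T ∧ c * (T.1.card : ℤ) = κ} = ∅ := by
      ext T
      refine ⟨?_, fun h => h.elim⟩
      rintro ⟨hT, h'⟩
      obtain ⟨rfl, rfl⟩ := (h T).1 hT
      exact hs ⟨rfl, by simpa using h'.symm⟩
    rw [completionCount, this, Set.ncard_empty, Nat.cast_zero]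

/-- Decomposition of completions according to the tile at the first empty cell. -/
theorem completionCount_eq (c : ℤ) (Q : Finset ℕ) {s : Finset ℕ} {n : ℕ} (hn : 0 < n)
    (hs : 0 ∉ s) (κ : ℤ) :
    completionCount c Q s n κ =
      completionCount c Q (placeTile Q s .square) n (κ - c * (Tile.square).combs) +
      completionCount c Q (placeTile Q s .comb) n (κ - c * (Tile.comb).combs) := by
  let S : Tile → Set (Finset ℕ × Finset ℕ) := fun t =>
    {T | Completes Q (placeTile Q s t) n T ∧ c * T.1.card = κ - c * t.combs}
  have hS : ∀ t, ∀ T ∈ S t, 0 ∉ T.1 ∧ 0 ∉ T.2 := fun t T hT =>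
    hT.1.zero_not_mem (zero_mem_placeTile Q s t)
  have hinj : ∀ t, Set.InjOn (addTile t) (S t) := by
    intro t T hT T' hT' h
    obtain ⟨h1, h2⟩ := hS t T hT
    obtain ⟨h1', h2'⟩ := hS t T' hT'
    cases t with
    | square =>
      obtain ⟨h3, h4⟩ := Prod.ext_iff.1 h
      refine Prod.ext h3 ?_
      rw [← Finset.erase_insert h2, ← Finset.erase_insert h2']
      exact congrArg (Finset.erase · 0) h4
    | comb =>
      obtain ⟨h3, h4⟩ := Prod.ext_iff.1 h
      refine Prod.ext ?_ h4
      rw [← Finset.erase_insert h1, ← Finset.erase_insert h1']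
      exact congrArg (Finset.erase · 0) h3
  have hcard : ∀ t (T : Finset ℕ × Finset ℕ), 0 ∉ T.1 →
      ((addTile t T).1.card : ℤ) = T.1.card + t.combs := by
    intro t T h
    cases t with
    | square => simp [addTile, Tile.combs]
    | comb => simp [addTile, Tile.combs, Finset.card_insert_of_notMem h]
  have himage : ∀ t, ∀ T ∈ S t, Completes Q s n (addTile t T) ∧
      c * (addTile t T).1.card = κ := by
    intro t T hT
    obtain ⟨h1, h2⟩ := hS t T hT
    refine ⟨(completes_addTile hn hs t h1 h2).2 hT.1, ?_⟩
    rw [hcard t T h1, mul_add, hT.2, sub_add_cancel]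
  have hback : ∀ t (T : Finset ℕ × Finset ℕ), 0 ∉ T.1 → 0 ∉ T.2 →
      Completes Q s n (addTile t T) → c * (addTile t T).1.card = κ →
      addTile t T ∈ addTile t '' S t := by
    intro t T h1 h2 h3 h4
    refine ⟨T, ⟨(completes_addTile hn hs t h1 h2).1 h3, ?_⟩, rfl⟩
    rw [hcard t T h1] at h4
    linarith
  -- Cell 0 is empty, so it is covered by a square there or by a comb, whose leftmost cell must then
  -- be 0.
  have hunion : {T | Completes Q s n T ∧ c * T.1.card = κ} =
      addTile .square '' S .square ∪ addTile .comb '' S .comb := by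
    ext T
    constructor
    · rintro ⟨h1, h2⟩
      rcases h1.cover 0 hn with h | h | ⟨k, hk, x, hx, h⟩
      · exact absurd h hs
      · left
        have h0 : 0 ∉ T.1 := fun h' => h1.square_comb 0 h 0 h' 0 (zero_mem_combCells Q) rfl
        have hT : addTile .square (T.1, T.2.erase 0) = T :=
          Prod.ext rfl (Finset.insert_erase h)
        have := hback .square (T.1, T.2.erase 0) h0 (Finset.notMem_erase 0 _)
        rw [hT] at this
        exact this h1 h2
      · right
        obtain rfl : k = 0 := by omega
        have h0 : 0 ∉ T.2 := fun h' => h1.square_comb 0 h' 0 hk 0 (zero_mem_combCells Q) rfl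
        have hT : addTile .comb (T.1.erase 0, T.2) = T :=
          Prod.ext (Finset.insert_erase hk) rfl
        have := hback .comb (T.1.erase 0, T.2) (Finset.notMem_erase 0 _) h0
        rw [hT] at this
        exact this h1 h2
    · rintro (⟨T, hT, rfl⟩ | ⟨T, hT, rfl⟩)
      · exact himage _ T hT
      · exact himage _ T hT
  have hfin : ∀ t, (S t).Finite := fun t =>
    (finite_completes Q (placeTile Q s t) n).subset fun T hT => hT.1
  have hdisj : Disjoint (addTile .square '' S .square) (addTile .comb '' S .comb) := by
    refine Set.disjoint_left.2 ?_
    rintro _ ⟨T, hT, rfl⟩ ⟨T', -, h⟩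
    refine (hS _ T hT).1 ?_
    rw [show T.1 = (addTile .square T).1 from rfl, ← h]
    exact Finset.mem_insert_self _ _
  rw [completionCount, hunion, Set.ncard_union_eq hdisj ((hfin _).image _) ((hfin _).image _),
    (hinj _).ncard_image, (hinj _).ncard_image, Nat.cast_add]
  rfl

/-! ### Moving the origin to the first empty cell -/

/-- The first empty cell. -/
noncomputable def firstEmpty (u : Finset ℕ) : ℕ := sInf {i : ℕ | i ∉ u}

theorem firstEmpty_not_mem (u : Finset ℕ) : firstEmpty u ∉ u := by
  have : {i : ℕ | i ∉ u}.Nonempty := Infinite.exists_notMem_finset u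
  exact Nat.sInf_mem this

theorem mem_of_lt_firstEmpty {u : Finset ℕ} {i : ℕ} (h : i < firstEmpty u) : i ∈ u := by
  by_contra hc
  exact Nat.notMem_of_lt_sInf h hc

theorem firstEmpty_le {u : Finset ℕ} {i : ℕ} (h : i ∉ u) : firstEmpty u ≤ i := Nat.sInf_le h

theorem mem_dropFilled {u : Finset ℕ} {i : ℕ} : i ∈ dropFilled u ↔ i + firstEmpty u ∈ u := by
  change i ∈ (u.filter (firstEmpty u < ·)).image (· - firstEmpty u) ↔ _
  simp only [Finset.mem_image, Finset.mem_filter]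
  constructor
  · rintro ⟨x, ⟨h1, h2⟩, rfl⟩
    rwa [Nat.sub_add_cancel h2.le]
  · intro h
    refine ⟨_, ⟨h, ?_⟩, by simp⟩
    rcases Nat.eq_zero_or_pos i with rfl | hi
    · rw [zero_add] at h
      exact absurd h (firstEmpty_not_mem u)
    · omega

theorem extent_le_iff {u : Finset ℕ} {N : ℕ} : extent u ≤ N ↔ ∀ x ∈ u, x < N := by
  simp only [extent, Finset.sup_le_iff, Nat.add_one_le_iff]

theorem lt_extent {u : Finset ℕ} {x : ℕ} (h : x ∈ u) : x < extent u :=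
  extent_le_iff.1 le_rfl x h

theorem firstEmpty_le_extent (u : Finset ℕ) : firstEmpty u ≤ extent u :=
  firstEmpty_le fun h => lt_irrefl _ (lt_extent h)

/-- If nothing is filled beyond the first empty cell, the label is empty with extent 0 and the first
empty cell is itself the extent. -/
theorem extent_dropFilled (u : Finset ℕ) : extent (dropFilled u) + firstEmpty u = extent u := by
  refine le_antisymm ?_ (extent_le_iff.2 fun x hx => ?_)
  · have h := firstEmpty_le_extent u
    have : extent (dropFilled u) ≤ extent u - firstEmpty u := by
      refine extent_le_iff.2 fun x hx => ?_
      have := lt_extent (mem_dropFilled.1 hx)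
      omega
    omega
  · by_cases h : x < firstEmpty u
    · omega
    · have : x - firstEmpty u ∈ dropFilled u := by
        rw [mem_dropFilled, Nat.sub_add_cancel (by omega)]
        exact hx
      have := lt_extent this
      omega

/-- Translate a tiling by `j`. -/
def shiftTiling (j : ℕ) (T : Finset ℕ × Finset ℕ) : Finset ℕ × Finset ℕ :=
  (T.1.map (addRightEmbedding j), T.2.map (addRightEmbedding j))

theorem shiftTiling_injective (j : ℕ) : Function.Injective (shiftTiling j) := by
  intro T T' h
  obtain ⟨h1, h2⟩ := Prod.ext_iff.1 h
  exact Prod.ext (Finset.map_injective _ h1) (Finset.map_injective _ h2)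

theorem map_addRight_image_sub {j : ℕ} {t : Finset ℕ} (h : ∀ x ∈ t, j ≤ x) :
    (t.image (· - j)).map (addRightEmbedding j) = t := by
  ext x
  simp only [Finset.mem_map, Finset.mem_image, addRightEmbedding_apply]
  constructor
  · rintro ⟨_, ⟨y, hy, rfl⟩, rfl⟩
    rwa [Nat.sub_add_cancel (h y hy)]
  · intro hx
    exact ⟨_, ⟨x, hx, rfl⟩, Nat.sub_add_cancel (h x hx)⟩

theorem completes_shiftTiling {Q u : Finset ℕ} {n : ℕ} (hn : firstEmpty u ≤ n)
    {T : Finset ℕ × Finset ℕ} :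
    Completes Q u n (shiftTiling (firstEmpty u) T) ↔
      Completes Q (dropFilled u) (n - firstEmpty u) T := by
  obtain ⟨T₁, T₂⟩ := T
  have hlow := fun i => mem_of_lt_firstEmpty (u := u) (i := i)
  have hdrop := fun i => mem_dropFilled (u := u) (i := i)
  set j := firstEmpty u
  constructor
  · rintro ⟨a1, a2, a3, a4, a5, a6, a7, a8⟩
    simp only [shiftTiling, Finset.forall_mem_map, addRightEmbedding_apply] at a2 a3 a4 a5 a6 a7
    refine ⟨?_, ?_, ?_, ?_, ?_, ?_, ?_, ?_⟩
    · intro x hx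
      have := a1 _ ((hdrop x).1 hx)
      omega
    · intro c hc x hx
      have := a2 c hc x hx
      omega
    · intro t ht
      have := a3 t ht
      omega
    · exact fun c hc h => a4 c hc ((hdrop c).1 h)
    · exact fun t ht h => a5 t ht ((hdrop t).1 h)
    · intro c hc c' hc' hne x hx h
      exact a6 c hc c' hc' (by omega) x hx (by omega)
    · intro t ht c hc x hx h
      exact a7 t ht c hc x hx (by omega)
    · intro i hi
      rcases a8 (i + j) (by omega) with h | h | ⟨c, hc, x, hx, h⟩
      · exact Or.inl ((hdrop i).2 h)
      · obtain ⟨t, ht, h⟩ := Finset.mem_map.1 h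
        rw [addRightEmbedding_apply] at h
        exact Or.inr (Or.inl ((show t = i by omega) ▸ ht))
      · obtain ⟨k, hk, rfl⟩ := Finset.mem_map.1 hc
        rw [addRightEmbedding_apply] at h
        exact Or.inr (Or.inr ⟨k, hk, x, hx, by omega⟩)
  · rintro ⟨a1, a2, a3, a4, a5, a6, a7, a8⟩
    refine ⟨?_, ?_, ?_, ?_, ?_, ?_, ?_, ?_⟩ <;>
      try simp only [shiftTiling, Finset.forall_mem_map, addRightEmbedding_apply]
    · intro x hx
      by_cases h : x < j
      · omega
      · have := a1 (x - j) ((hdrop _).2 (by rwa [Nat.sub_add_cancel (by omega)]))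
        omega
    · intro c hc x hx
      have := a2 c hc x hx
      omega
    · intro t ht
      have := a3 t ht
      omega
    · exact fun c hc h => a4 c hc ((hdrop c).2 h)
    · exact fun t ht h => a5 t ht ((hdrop t).2 h)
    · intro c hc c' hc' hne x hx h
      exact a6 c hc c' hc' (by rintro rfl; exact hne rfl) x hx (by omega)
    · intro t ht c hc x hx h
      exact a7 t ht c hc x hx (by omega)
    · intro i hi
      by_cases h : i < j
      · exact Or.inl (hlow i h)
      · rcases a8 (i - j) (by omega) with h' | h' | ⟨c, hc, x, hx, h'⟩
        · rw [hdrop, Nat.sub_add_cancel (by omega)] at h'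
          exact Or.inl h'
        · exact Or.inr (Or.inl (Finset.mem_map.2 ⟨_, h', by
            rw [addRightEmbedding_apply]; omega⟩))
        · exact Or.inr (Or.inr ⟨c + j, Finset.mem_map.2 ⟨c, hc, rfl⟩, x, hx, by omega⟩)

/-- Leftmost cells avoid the filled cells, so none lies before the first empty one and every
completion is a translate. -/
theorem completionCount_dropFilled (c : ℤ) (Q : Finset ℕ) {u : Finset ℕ} {n : ℕ}
    (hn : firstEmpty u ≤ n) (κ : ℤ) :
    completionCount c Q u n κ = completionCount c Q (dropFilled u) (n - firstEmpty u) κ := by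
  rw [completionCount, completionCount,
    ← Set.ncard_image_of_injective {T | Completes Q (dropFilled u) (n - firstEmpty u) T ∧ _}
      (shiftTiling_injective (firstEmpty u))]
  refine congrArg (fun S : Set (Finset ℕ × Finset ℕ) => (S.ncard : ℤ)) (Set.ext fun T => ?_)
  constructor
  · rintro ⟨h1, h2⟩
    have hle : ∀ x, x ∉ u → firstEmpty u ≤ x := fun x hx => firstEmpty_le hx
    have hT : shiftTiling (firstEmpty u)
        (T.1.image (· - firstEmpty u), T.2.image (· - firstEmpty u)) = T :=
      Prod.ext (map_addRight_image_sub fun x hx => hle x (h1.comb_not_mem x hx))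
        (map_addRight_image_sub fun x hx => hle x (h1.square_not_mem x hx))
    refine ⟨_, ⟨(completes_shiftTiling hn).1 (hT.symm ▸ h1), ?_⟩, hT⟩
    rw [← h2, ← congrArg (fun T => T.1.card) hT]
    simp [shiftTiling]
  · rintro ⟨T, ⟨h1, h2⟩, rfl⟩
    refine ⟨(completes_shiftTiling hn).2 h1, ?_⟩
    rw [← h2]
    simp [shiftTiling]

theorem completionCount_eq_zero (c : ℤ) (Q : Finset ℕ) {u : Finset ℕ} {n : ℕ}
    (hn : n < extent u) (κ : ℤ) : completionCount c Q u n κ = 0 := by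
  have : {T | Completes Q u n T ∧ c * T.1.card = κ} = ∅ := by
    ext T
    refine ⟨fun h => ?_, fun h => h.elim⟩
    exact absurd (extent_le_iff.2 h.1.filled_lt) (by omega)
  rw [completionCount, this, Set.ncard_empty, Nat.cast_zero]

/-! ### Walks in the metatile-generating digraph -/

namespace TileDigraph

open ShiftFun

variable {V A : Type*} {D : TileDigraph V A}

theorem IsMetatileGenerating.zero_not_mem_label {Q : Finset ℕ} {label : V → Finset ℕ}
    (h : D.IsMetatileGenerating Q label) (w : V) : 0 ∉ label w := by
  have hr : IsReachableLabel Q (label w) := (h.range_label _).1 ⟨w, rfl⟩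
  rcases Relation.ReflTransGen.cases_tail hr with h0 | ⟨u, -, t, ht⟩
  · rw [h0]; simp
  · rw [ht, mem_dropFilled, zero_add]
    exact firstEmpty_not_mem _

/-- Both sides obey the same recursion. Measured from the first empty cell, the label already
accounts for `extent (label w)` cells, so a walk has `n - extent (label w)` still to add. -/
theorem IsMetatileGenerating.completionCount_label [Finite V] [Finite A]
    (hpos : ∀ c : Cycle A, D.IsCycle c → 0 < D.len c.toMultiset)
    {Q : Finset ℕ} {label : V → Finset ℕ} (h : D.IsMetatileGenerating Q label) (c : ℤ)
    (n : ℕ) (w : V) (κ : ℤ) :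
    completionCount c Q (label w) n κ = D.walkCount c w (n - extent (label w), κ) := by
  classical
  induction n using Nat.strong_induction_on generalizing w κ with
  | h n ih =>
    choose arc harc harc' using fun t => h.arcs w t
    have hne : arc .square ≠ arc .comb := by
      intro he
      have h1 := (harc .square).2
      rw [he, (harc .comb).2] at h1
      cases h1
    have hout : D.outArcs w = {arc .square, arc .comb} := by
      ext a
      constructor
      · intro ha
        cases ht : D.tile a with
        | square => exact Or.inl (harc' _ a ⟨ha, ht⟩)
        | comb => exact Or.inr (harc' _ a ⟨ha, ht⟩)
      · rintro (rfl | rfl)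
        · exact (harc _).1
        · exact (harc _).1
    let u : Tile → Finset ℕ := fun t => placeTile Q (label w) t
    have hu0 : ∀ t, 0 ∈ u t := fun t => zero_mem_placeTile _ _ _
    have hlabel : ∀ t, label (D.tgt (arc t)) = dropFilled (u t) := by
      intro t
      rw [h.label_tgt, (harc t).1, (harc t).2]
    have hterm : ∀ t, (T (D.arcWeight c (arc t)) • D.walkCount c (D.tgt (arc t)))
        (n - extent (label w), κ) =
        D.walkCount c (D.tgt (arc t)) (n - extent (u t), κ - c * t.combs) := by
      intro t
      rw [T_smul_apply]
      congr 1
      have hle : extent (label w) ≤ extent (u t) :=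
        extent_le_iff.2 fun x hx => lt_extent (Finset.mem_union_left _ hx)
      have hi := h.incr_eq (arc t)
      rw [(harc t).1, (harc t).2] at hi
      refine Prod.ext ?_ ?_
      · simp only [arcWeight, Prod.fst_sub, hi]
        change (n : ℤ) - _ - ((extent (u t) - extent (label w) : ℕ) : ℤ) = _
        rw [Nat.cast_sub hle]
        ring
      · simp only [arcWeight, Prod.snd_sub, (harc t).2]
    have hX := congrFun (D.walkCount_eq hpos c w) (n - extent (label w), κ)
    rw [ShiftFun.add_apply, hout, finsum_mem_pair hne, ShiftFun.add_apply, hterm, hterm] at hX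
    rw [hX]
    have hext : ∀ t, 0 < extent (u t) := fun t => lt_extent (hu0 t)
    have hw : w = D.zero ↔ label w = ∅ := by
      rw [← h.label_zero]
      exact h.label_injective.eq_iff.symm
    rcases Nat.eq_zero_or_pos n with rfl | hn
    -- After any further tile the filled extent is positive, so on an empty board only the empty
    -- walk can contribute.
    · have hz : ∀ t κ', D.walkCount c (D.tgt (arc t)) (((0 : ℕ) : ℤ) - extent (u t), κ') = 0 :=
        fun t κ' => D.walkCount_eq_zero c _ (by have := hext t; simp; omega)
      rw [hz, hz, add_zero, add_zero, completionCount_zero]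
      by_cases h0 : label w = ∅
      · rw [if_pos (hw.2 h0)]
        simp [delta, kdelta, h0, extent]
      · rw [if_neg (mt hw.1 h0), if_neg fun h => h0 h.1]
        rfl
    · have hd : (if w = D.zero then delta else 0) ((n : ℤ) - extent (label w), κ) = 0 := by
        split_ifs with h0
        · rw [hw.1 h0]
          have : n ≠ 0 := by omega
          simp [delta, kdelta, extent, this]
        · rfl
      have hc : ∀ t κ', completionCount c Q (u t) n κ' =
          D.walkCount c (D.tgt (arc t)) (n - extent (u t), κ') := by
        intro t κ'
        -- If the filled cells exceed the board, both counts vanish.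
        by_cases hnu : n < extent (u t)
        · rw [completionCount_eq_zero c Q hnu,
            D.walkCount_eq_zero c _ (show (n : ℤ) - extent (u t) < 0 by omega)]
        · have h1 := firstEmpty_le_extent (u t)
          -- Placing a tile fills cell 0, so dropping the leading filled cells strictly shortens the
          -- board and the induction applies.
          have h2 : 0 < firstEmpty (u t) := by
            refine Nat.pos_of_ne_zero fun h => firstEmpty_not_mem (u t) ?_
            rw [h]
            exact hu0 t
          have h3 := extent_dropFilled (u t)
          rw [completionCount_dropFilled c Q (by omega), ← hlabel t, ih _ (by omega), hlabel]
          congr 2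
          omega
      rw [hd, zero_add, completionCount_eq c Q hn (h.zero_not_mem_label w)]
      exact congrArg₂ (· + ·) (hc _ _) (hc _ _)

end TileDigraph

/-! ### From the operator identity to the numerical recurrences -/

namespace ShiftFun

/-- The scalar form of the recurrence. -/
theorem apply_eq_of_recurrence {f : ShiftFun} {N : ℕ} {L K : Fin 4 → ℤ} {lo ko : Fin N → ℤ}
    {lc kc : Fin 2 → ℤ} {t : Fin 4 → AddMonoidAlgebra ℤ (ℤ × ℤ)} (ht : ∀ r, t r = T (L r, K r))
    (h : (1 - t 0 - t 1 - t 2 - t 3 + t 0 * t 3 + t 1 * t 2 + t 2 * t 3) • f =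
      (1 - t 0 - t 1 - t 2 - t 3 + t 0 * t 3 + t 1 * t 2 + t 2 * t 3) •
        (delta + (∑ i, T (lo i, ko i)) • f) +
      (T (lc 0, kc 0) * (1 - t 3) + T (lc 1, kc 1) * (1 - t 2)) • f) (n k : ℤ) :
    f (n, k) = kdelta n 0 * kdelta k 0
        + ∑ r, (f (n - L r, k - K r) - kdelta n (L r) * kdelta k (K r))
        + kdelta n (L 0 + L 3) * kdelta k (K 0 + K 3) - f (n - L 0 - L 3, k - K 0 - K 3)
        + kdelta n (L 1 + L 2) * kdelta k (K 1 + K 2) - f (n - L 1 - L 2, k - K 1 - K 2)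
        + kdelta n (L 2 + L 3) * kdelta k (K 2 + K 3) - f (n - L 2 - L 3, k - K 2 - K 3)
        + ∑ i, (f (n - lo i, k - ko i)
            - ∑ r, f (n - lo i - L r, k - ko i - K r)
            + f (n - lo i - L 0 - L 3, k - ko i - K 0 - K 3)
            + f (n - lo i - L 1 - L 2, k - ko i - K 1 - K 2)
            + f (n - lo i - L 2 - L 3, k - ko i - K 2 - K 3))
        + ((f (n - lc 0, k - kc 0) - f (n - lc 0 - L 3, k - kc 0 - K 3))
          + (f (n - lc 1, k - kc 1) - f (n - lc 1 - L 2, k - kc 1 - K 2))) := by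
  -- The identity is solved for `f` with products of translations written as successive actions, so
  -- that evaluation yields the iterated shifts of the statement.
  have h' : f = delta + (t 0 • f - t 0 • delta + (t 1 • f - t 1 • delta)
        + (t 2 • f - t 2 • delta) + (t 3 • f - t 3 • delta))
      + t 0 • t 3 • delta - t 0 • t 3 • f + t 1 • t 2 • delta - t 1 • t 2 • f
      + t 2 • t 3 • delta - t 2 • t 3 • f
      + ∑ i, T (lo i, ko i) • (f - (t 0 • f + t 1 • f + t 2 • f + t 3 • f)
        + t 0 • t 3 • f + t 1 • t 2 • f + t 2 • t 3 • f)
      + ((T (lc 0, kc 0) • f - T (lc 0, kc 0) • t 3 • f)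
        + (T (lc 1, kc 1) • f - T (lc 1, kc 1) • t 2 • f)) := by
    rw [← Finset.sum_smul]
    linear_combination (norm := module) h
  have hk : ∀ a b c : ℤ, kdelta (a - b) c = kdelta a (b + c) := fun a b c => by
    simp only [kdelta, sub_eq_iff_eq_add, add_comm]
  have := congrFun h' (n, k)
  simp only [ht, ShiftFun.add_apply, ShiftFun.sub_apply, ShiftFun.sum_apply, T_smul_apply,
    delta, Prod.mk_sub_mk, hk, add_zero] at this
  simp only [Fin.sum_univ_four]
  exact this

end ShiftFun

namespace TileDigraph

variable {V A : Type*} (D : TileDigraph V A)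

theorem B_eq_walkCount (n : ℤ) : D.B n = D.walkCount 0 D.zero (n, 0) := by
  simp [B, walkCount, weight]

theorem Bk_eq_walkCount (n k : ℤ) : D.Bk n k = D.walkCount 1 D.zero (n, k) := by
  simp [Bk, walkCount, weight]

end TileDigraph

theorem completionCount_zero_eq_tilingCount (Q : Finset ℕ) (n : ℕ) :
    completionCount 0 Q ∅ n 0 = tilingCount Q n := by
  simp [completionCount, tilingCount, isTiling_iff_completes]

theorem completionCount_one_eq_tilingCountCombs (Q : Finset ℕ) (n k : ℕ) :
    completionCount 1 Q ∅ n k = tilingCountCombs Q n k := by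
  simp [completionCount, tilingCountCombs, isTiling_iff_completes]

theorem theorem6 {V A : Type*} [Finite V] [Finite A] (D : TileDigraph V A)
    -- adding a comb lengthens the incomplete metatile, and all cycles have positive length
    (hcomb : ∀ a, D.tile a = Tile.comb → 0 < D.incr a)
    (hpos : ∀ c : Cycle A, D.IsCycle c → 0 < D.len c.toMultiset)
    -- the pseudo-common node and the two errant loops
    (P : V) (E : Fin 2 → A) (hE : D.IsErrantFamily P (Set.range E))
    -- `C` lists the inner cycles: there are exactly four, the last two of them the errant loops,
    -- which are attached to the first and to the second one, respectively
    (C : Fin 4 ≃ {c : Cycle A // D.IsInnerCycle c})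
    (hC2 : (C 2 : Cycle A) = (([E 0] : List A) : Cycle A))
    (hC3 : (C 3 : Cycle A) = (([E 1] : List A) : Cycle A))
    (hatt0 : D.OnCycle (D.src (E 0)) (C 0)) (hatt1 : D.OnCycle (D.src (E 1)) (C 1))
    -- `cc` lists the common circuits: there are exactly two, the `i`-th of which goes through
    -- the errant loop node of the `i`-th inner cycle, either after `P` for both or before `P`
    -- for both
    (cc : Fin 2 ≃ {w : List A × List A // D.IsCommonCircuit P w})
    (hcc : (∀ i, D.src (E i) ∈ D.visited P (cc i).1.2 ∧
              D.src (E i) ∉ D.visited D.zero (cc i).1.1) ∨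
           (∀ i, D.src (E i) ∈ D.visited D.zero (cc i).1.1 ∧
              D.src (E i) ∉ D.visited P (cc i).1.2))
    -- `o` lists the outer cycles
    (No : ℕ) (o : Fin No ≃ {c : Cycle A // D.IsOuterCycle P c})
    -- their lengths and their numbers of combs
    (L K : Fin 4 → ℤ) (lo ko : Fin No → ℤ) (lc kc : Fin 2 → ℤ)
    (hL : ∀ r, L r = D.len (C r : Cycle A).toMultiset)
    (hK : ∀ r, K r = D.combs (C r : Cycle A).toMultiset)
    (hlo : ∀ i, lo i = D.len (o i : Cycle A).toMultiset)
    (hko : ∀ i, ko i = D.combs (o i : Cycle A).toMultiset)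
    (hlc : ∀ i, lc i = D.len ((cc i).1.1 ++ (cc i).1.2 : List A))
    (hkc : ∀ i, kc i = D.combs ((cc i).1.1 ++ (cc i).1.2 : List A)) :
    (∀ n : ℤ,
      D.B n = kdelta n 0
        + ∑ r, (D.B (n - L r) - kdelta n (L r))
        + kdelta n (L 0 + L 3) - D.B (n - L 0 - L 3)
        + kdelta n (L 1 + L 2) - D.B (n - L 1 - L 2)
        + kdelta n (L 2 + L 3) - D.B (n - L 2 - L 3)
        + ∑ i, (D.B (n - lo i)
            + D.B (n - lo i - L 0 - L 3)
            + D.B (n - lo i - L 1 - L 2)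
            + D.B (n - lo i - L 2 - L 3)
            - ∑ r, D.B (n - lo i - L r))
        + ((D.B (n - lc 0) - D.B (n - lc 0 - L 3))
          + (D.B (n - lc 1) - D.B (n - lc 1 - L 2)))) ∧
    (∀ n k : ℤ,
      D.Bk n k = kdelta n 0 * kdelta k 0
        + ∑ r, (D.Bk (n - L r) (k - K r) - kdelta n (L r) * kdelta k (K r))
        + kdelta n (L 0 + L 3) * kdelta k (K 0 + K 3) - D.Bk (n - L 0 - L 3) (k - K 0 - K 3)
        + kdelta n (L 1 + L 2) * kdelta k (K 1 + K 2) - D.Bk (n - L 1 - L 2) (k - K 1 - K 2)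
        + kdelta n (L 2 + L 3) * kdelta k (K 2 + K 3) - D.Bk (n - L 2 - L 3) (k - K 2 - K 3)
        + ∑ i, (D.Bk (n - lo i) (k - ko i)
            - ∑ r, D.Bk (n - lo i - L r) (k - ko i - K r)
            + D.Bk (n - lo i - L 0 - L 3) (k - ko i - K 0 - K 3)
            + D.Bk (n - lo i - L 1 - L 2) (k - ko i - K 1 - K 2)
            + D.Bk (n - lo i - L 2 - L 3) (k - ko i - K 2 - K 3))
        + ((D.Bk (n - lc 0) (k - kc 0) - D.Bk (n - lc 0 - L 3) (k - kc 0 - K 3))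
          + (D.Bk (n - lc 1) (k - kc 1) - D.Bk (n - lc 1 - L 2) (k - kc 1 - K 2)))) ∧
    -- the conventions on the range of the indices
    (∀ n : ℤ, n < 0 → D.B n = 0) ∧
    (∀ n k : ℤ, k < 0 ∨ n < k → D.Bk n k = 0) ∧
    -- for the metatile-generating digraph of squares and `Q`-combs these are the tiling counts
    (∀ (Q : Finset ℕ) (label : V → Finset ℕ), D.IsMetatileGenerating Q label →
      (∀ n : ℕ, (tilingCount Q n : ℤ) = D.B n) ∧
      (∀ n k : ℕ, (tilingCountCombs Q n k : ℤ) = D.Bk n k)) := by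
  -- Both recurrences are instances of this one, with `c = 0` and `c = 1`.
  have hrec : ∀ c : ℤ, _ := fun c => ShiftFun.apply_eq_of_recurrence
    (f := D.walkCount c D.zero) (L := L) (K := fun r => c * K r) (lo := lo)
    (ko := fun i => c * ko i) (lc := lc) (kc := fun i => c * kc i)
    (t := fun r => ShiftFun.T (L r, c * K r)) (fun _ => rfl) (by
      have h := TileDigraph.walkCount_recurrence hpos hE C hC2 hC3 hatt0 hatt1 cc hcc o c
        (t := fun r => ShiftFun.T (L r, c * K r)) (fun r => by
          rw [hL, hK]; rfl)
      simp only [TileDigraph.multisetWeight, TileDigraph.weight, ← hlo, ← hko, ← hlc, ← hkc] at h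
      exact h)
  refine ⟨fun n => ?_, fun n k => ?_, fun n hn => ?_, fun n k hnk => ?_, fun Q label h => ⟨?_, ?_⟩⟩
  · have h := hrec 0 n 0
    simp only [zero_mul, sub_zero, add_zero, ← D.B_eq_walkCount] at h
    have h0 : kdelta 0 0 = 1 := rfl
    simp only [h0, mul_one] at h
    rw [h]
    -- The two sides differ only in the order of the summands for the outer cycles.
    congr 2
    exact Finset.sum_congr rfl fun i _ => by ring
  · have h := hrec 1 n k
    simp only [one_mul, ← D.Bk_eq_walkCount] at h
    exact h
  · rw [D.B_eq_walkCount]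
    exact D.walkCount_eq_zero 0 D.zero hn
  · have : {l : List A | D.IsWalk D.zero D.zero l ∧ (D.len l : ℤ) = n ∧
        (D.combs l : ℤ) = k} = ∅ := by
      ext l
      refine ⟨?_, fun h => h.elim⟩
      rintro ⟨-, rfl, rfl⟩
      have := D.combs_le_len hcomb l
      omega
    rw [TileDigraph.Bk, this, Set.ncard_empty, Nat.cast_zero]
  · intro n
    have := h.completionCount_label hpos 0 n D.zero 0
    rw [h.label_zero, completionCount_zero_eq_tilingCount] at this
    rw [this, D.B_eq_walkCount]
    simp [extent]
  · intro n k
    have := h.completionCount_label hpos 1 n D.zero k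
    rw [h.label_zero, completionCount_one_eq_tilingCountCombs] at this
    rw [this, D.Bk_eq_walkCount]
    simp [extent]
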